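/- Let $\mathbb H$ be the upper half-plane, $q=e^{2\pi i z}$, $\lambda(z)=\Theta_2^4(z)/\Theta_3^4(z)$ with $\Theta_2(z)=q^{1/8}\sum_{n\in\mathbb Z}q^{n(n+1)/2}$ and $\Theta_3(z)=\sum_{n\in\mathbb Z}q^{n^2/2}$. For an integer $k\ge 2$ put $$E_{2k}^{\pm}(z)=\frac12\Bigl(\sum_{\substack{(c,d)\equiv(0,1)\ (2)\\ \gcd(c,d)=1}}\frac1{(cz+d)^{2k}}\ \pm\sum_{\substack{(c,d)\equiv(1,0)\ (2)\\ \gcd(c,d)=1}}\frac1{(cz+d)^{2k}}\Bigr).$$ Then $E_{2k}^{+}$ and $E_{2k}^{-}$ are holomorphic and not identically zero on $\mathbb H$, their zeros lie in finitely many $\Gamma(2)$-orbits, and $$k=\sum_{\tau\in\mathbb H/\Gamma(2)}\bigl(\mathrm{ord}_\tau(E_{2k}^+)+\mathrm{ord}_\tau(E_{2k}^-)\bigr)\frac1{\lambda(\tau)}=\sum_{\tau\in\mathbb H/\Gamma(2)}\mathrm{ord}_\tau(E_{2k}^+E_{2k}^-)\frac1{\lambda(\tau)},$$ where $\mathrm{ord}_\tau(f)$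 is the order of vanishing of $f$ at $\tau$ and the sums may be taken over any system of representatives of the $\Gamma(2)$-orbits. -/

import Mathlib

open scoped UpperHalfPlane

noncomputable section

/-- The theta function `Θ₂(z) = q^{1/8} ∑ₙ q^{n(n+1)/2}`, where `q^a = exp(2πi a z)`. -/
def theta2 (z : ℍ) : ℂ :=
  Complex.exp (Real.pi * Complex.I * z / 4) *
    ∑' n : ℤ, Complex.exp (Real.pi * Complex.I * ((n : ℂ) * (n + 1)) * z)

/-- The theta function `Θ₃(z) = ∑ₙ q^{n²/2}`, where `q^a = exp(2πi a z)`. -/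
def theta3 (z : ℍ) : ℂ :=
  ∑' n : ℤ, Complex.exp (Real.pi * Complex.I * (n : ℂ) ^ 2 * z)

/-- The classical lambda function `λ = Θ₂⁴ / Θ₃⁴`. -/
def lambdaFn (z : ℍ) : ℂ := theta2 z ^ 4 / theta3 z ^ 4

/-- `S_k(a, b)(z)`: the sum of `(c z + d) ^ (-k)` over all coprime pairs of integers `(c, d)` with
`(c, d) ≡ (a, b)` modulo `2`. -/
def eisSum (k : ℤ) (a b : ZMod 2) (z : ℍ) : ℂ :=
  eisensteinSeries (N := 2) ![a, b] k z

/-- `E_{2k}^+ = (S_{2k}(0,1) + S_{2k}(1,0)) / 2`. -/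
def EPlus (k : ℕ) (z : ℍ) : ℂ := (1 / 2) * (eisSum (2 * k) 0 1 z + eisSum (2 * k) 1 0 z)

/-- `E_{2k}^- = (S_{2k}(0,1) - S_{2k}(1,0)) / 2`. -/
def EMinus (k : ℕ) (z : ℍ) : ℂ := (1 / 2) * (eisSum (2 * k) 0 1 z - eisSum (2 * k) 1 0 z)

/-- `f` is holomorphic at `τ` and does not vanish identically near `τ`. -/
def HolNonzeroAt (f : ℍ → ℂ) (τ : ℍ) : Prop :=
  AnalyticAt ℂ (f ∘ UpperHalfPlane.ofComplex) (τ : ℂ) ∧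
    analyticOrderAt (f ∘ UpperHalfPlane.ofComplex) (τ : ℂ) ≠ ⊤

/-- The order of vanishing at `τ` of a holomorphic function on the upper half-plane. -/
def ordAt (f : ℍ → ℂ) (τ : ℍ) : ℕ :=
  analyticOrderNatAt (f ∘ UpperHalfPlane.ofComplex) (τ : ℂ)

/-- The quotient of the upper half-plane by `Γ(2)`. -/
abbrev Y2 : Type := MulAction.orbitRel.Quotient (CongruenceSubgroup.Gamma 2) ℍ

/-- `rep` picks a representative in the upper half-plane of every `Γ(2)`-orbit. -/
def IsRepSystem (rep : Y2 → ℍ) : Prop :=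
  ∀ y : Y2, (Quotient.mk'' (rep y) : Y2) = y

end

/-! ### Theta functions: transformation under `S` and `T`, limits at infinity. -/

section Theta

open UpperHalfPlane hiding I
open Complex Filter Topology ModularGroup
open scoped Real Manifold

/-! A form of weight `2k` for `Γ(2)` is `Θ₃^{4k} P(λ)` with a polynomial `P`
(`IsGammaTwoForm.exists_polynomial`), and `λ` identifies the orbits of `Γ(2)` with `ℂ ∖ {0, 1}`.
Since `Θ₃` and `λ'` have no zeros, the order of the form at `τ` is the multiplicity of `λ(τ)` as a
root of `P`. If `P(0), P(1) ≠ 0`, the sum over orbits is thus `∑ 1/c` over the roots `c` of `P`,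
that is `-P'(0)/P(0)`.

Let `A`, `B` belong to the Eisenstein series of `(0,1)`, `(1,0)`, so that `E^±` belong to `(A ±
B)/2`. Only the first series survives at infinity and `S` swaps the two, so `A(0), B(1) ≠ 0` and
`A(1) = B(0) = 0`. The logarithmic derivatives of `A ± B` at `0` add up to `2A'(0)/A(0)`, and
invariance under `T` makes this `-k` (`derivative_eval_zero`).

The facts about `λ` rest on level one: a weight six form with sign character vanishing at infinity
has square a multiple of the discriminant, which handles `Θ₂⁴Θ₃⁴Θ₄⁴` and the Wronskian giving `λ'`.
If `λ` missed `c ≠ 0, 1`, then `1/(Θ₂⁴ - cΘ₃⁴)` would have negative weight. For injectivity modulo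
`Γ(2)`, the value `λ(z)` fixes all Eisenstein series at `z` up to powers of one scalar; these are
power sums of the numbers `(cz+d)⁻²`, hence determine these numbers, from which the matrix is read
off. -/

/-- The theta function `Θ₄(z) = Θ₃(z + 1)`. -/
noncomputable def theta4 (z : ℍ) : ℂ := jacobiTheta ((z : ℂ) + 1)

/-- The fourth power of `Θ₂`. -/
noncomputable def H₂ (z : ℍ) : ℂ := theta2 z ^ 4

/-- The fourth power of `Θ₃`. -/
noncomputable def H₃ (z : ℍ) : ℂ := theta3 z ^ 4

/-- The fourth power of `Θ₄`. -/
noncomputable def H₄ (z : ℍ) : ℂ := theta4 z ^ 4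

lemma theta3_eq_jacobiTheta (z : ℍ) : theta3 z = jacobiTheta z := rfl

lemma tsum_theta2_eq_jacobiTheta₂ (z : ℂ) :
    ∑' n : ℤ, exp (π * I * ((n : ℂ) * (n + 1)) * z) = jacobiTheta₂ (z / 2) z :=
  tsum_congr fun n ↦ by rw [jacobiTheta₂_term]; congr 1; ring

lemma theta2_eq_jacobiTheta₂ (z : ℍ) :
    theta2 z = exp (π * I * z / 4) * jacobiTheta₂ ((z : ℂ) / 2) z := by
  rw [theta2, tsum_theta2_eq_jacobiTheta₂]

/-- As `n² ≡ n` modulo `2`, the shift of `z` becomes a shift of the elliptic variable; the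
functional equation of `jacobiTheta₂` then exchanges `Θ₄` and `Θ₂`. -/
lemma theta4_eq_jacobiTheta₂ (z : ℍ) : theta4 z = jacobiTheta₂ (1 / 2) z := by
  rw [theta4, jacobiTheta, jacobiTheta₂]
  refine tsum_congr fun n ↦ ?_
  rw [jacobiTheta₂_term, mul_add, Complex.exp_add, Complex.exp_add, mul_comm]
  congr 1
  obtain ⟨m, hm⟩ : ∃ m : ℤ, n ^ 2 = n + 2 * m := by
    obtain ⟨m, hm⟩ := Int.even_mul_succ_self (n - 1)
    exact ⟨m, by linarith⟩
  have hm' : (n : ℂ) ^ 2 = n + 2 * m := mod_cast hm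
  rw [hm', show π * I * (n + 2 * m : ℂ) * 1 = 2 * π * I * n * (1 / 2) + m * (2 * π * I) by ring,
    Complex.exp_add, exp_int_mul_two_pi_mul_I, mul_one]

lemma coe_T_smul (z : ℍ) : ((T • z : ℍ) : ℂ) = z + 1 := by
  rw [modular_T_smul, coe_vadd, add_comm]; simp

lemma coe_S_smul (z : ℍ) : ((S • z : ℍ) : ℂ) = -1 / z := by
  rw [modular_S_smul]; simp [neg_div, ← inv_neg]

lemma H₃_T_smul (z : ℍ) : H₃ (T • z) = H₄ z := by
  rw [H₃, H₄, theta3_eq_jacobiTheta, coe_T_smul, theta4]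

lemma H₄_T_smul (z : ℍ) : H₄ (T • z) = H₃ z := by
  rw [H₃, H₄, theta3_eq_jacobiTheta, theta4, coe_T_smul,
    ← jacobiTheta_two_add (z : ℂ)]
  congr 2; ring

lemma H₂_T_smul (z : ℍ) : H₂ (T • z) = -H₂ z := by
  have h : ∑' n : ℤ, exp (π * I * ((n : ℂ) * (n + 1)) * (z + 1 : ℂ)) =
      ∑' n : ℤ, exp (π * I * ((n : ℂ) * (n + 1)) * z) := by
    refine tsum_congr fun n ↦ ?_
    obtain ⟨m, hm⟩ := Int.even_mul_succ_self n
    have hm' : (n : ℂ) * (n + 1) = m + m := mod_cast hm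
    rw [hm', show π * I * (m + m : ℂ) * (z + 1) = π * I * (m + m : ℂ) * z + m * (2 * π * I) by ring,
      Complex.exp_add, exp_int_mul_two_pi_mul_I, mul_one]
  have h4 : exp (π * I * (z + 1 : ℂ) / 4) ^ 4 = -exp (π * I * z / 4) ^ 4 := by
    rw [← Complex.exp_nat_mul, ← Complex.exp_nat_mul,
      show ((4 : ℕ) : ℂ) * (π * I * (z + 1 : ℂ) / 4) = ((4 : ℕ) : ℂ) * (π * I * z / 4) + π * I by
        push_cast; ring, Complex.exp_add, exp_pi_mul_I, mul_neg_one]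
  rw [H₂, H₂, theta2, theta2, coe_T_smul, h, mul_pow, mul_pow, h4, neg_mul]

/-- Fourth powers remove the branch of the square root. -/
lemma cpow_half_pow_four (z : ℂ) : ((-I * z) ^ (1 / 2 : ℂ)) ^ 4 = -z ^ 2 := by
  rw [← cpow_nat_mul, show ((4 : ℕ) : ℂ) * (1 / 2) = (2 : ℕ) by norm_num, cpow_natCast, mul_pow,
    neg_sq, I_sq]
  ring

lemma H₃_S_smul (z : ℍ) : H₃ (S • z) = -(z : ℂ) ^ 2 * H₃ z := by
  rw [H₃, H₃, theta3_eq_jacobiTheta, theta3_eq_jacobiTheta, jacobiTheta_S_smul, mul_pow,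
    cpow_half_pow_four]

lemma H₂_S_smul (z : ℍ) : H₂ (S • z) = -(z : ℂ) ^ 2 * H₄ z := by
  have hz := z.ne_zero
  have h : theta4 z = 1 / (-I * z) ^ (1 / 2 : ℂ) * theta2 (S • z) := by
    rw [theta4_eq_jacobiTheta₂, jacobiTheta₂_functional_equation, theta2_eq_jacobiTheta₂,
      coe_S_smul, ← jacobiTheta₂_neg_left, mul_assoc]
    congr 3
    · field_simp; norm_num
    · ring
  rw [H₄, h, mul_pow, H₂, one_div, inv_pow, cpow_half_pow_four]
  field_simp

lemma S_smul_S_smul (z : ℍ) : S • S • z = z := by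
  ext; rw [coe_S_smul, coe_S_smul]; field_simp [z.ne_zero]

lemma H₄_S_smul (z : ℍ) : H₄ (S • z) = -(z : ℂ) ^ 2 * H₂ z := by
  have h := H₂_S_smul (S • z)
  have hz := z.ne_zero
  rw [S_smul_S_smul, coe_S_smul] at h
  rw [h]; field_simp

lemma mdifferentiable_H₃ : MDiff H₃ :=
  mdifferentiable_jacobiTheta.pow 4

lemma H₄_eq_comp : H₄ = fun z ↦ H₃ (T • z) := funext fun z ↦ (H₃_T_smul z).symm

lemma mdifferentiable_theta2 : MDiff theta2 := by
  rw [mdifferentiable_iff]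
  have h : DifferentiableOn ℂ (fun z : ℂ ↦ exp (π * I * z / 4) * jacobiTheta₂ (z / 2) z)
      {z | 0 < z.im} := fun z hz ↦ by
    have h2 : DifferentiableAt ℂ (fun z : ℂ ↦ jacobiTheta₂ (z / 2) z) z :=
      (hasFDerivAt_jacobiTheta₂ (z / 2) hz).differentiableAt.comp z
        (f := fun z : ℂ ↦ (z / 2, z)) (by fun_prop)
    exact (DifferentiableAt.mul (by fun_prop) h2).differentiableWithinAt
  refine h.congr fun z hz ↦ ?_
  rw [Function.comp_apply, ofComplex_apply_of_im_pos hz, theta2_eq_jacobiTheta₂]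

lemma mdifferentiable_H₂ : MDiff H₂ := mdifferentiable_theta2.pow 4

lemma mdifferentiable_comp_T {f : ℍ → ℂ} (hf : MDiff f) : MDiff fun z ↦ f (T • z) :=
  hf.comp (mdifferentiable_smul (g := (T : GL (Fin 2) ℝ)) (by simp))

lemma mdifferentiable_H₄ : MDiff H₄ := H₄_eq_comp ▸ mdifferentiable_comp_T mdifferentiable_H₃

lemma tendsto_T_smul_atImInfty : Tendsto (fun z : ℍ ↦ T • z) atImInfty atImInfty := by
  refine tendsto_comap_iff.mpr (tendsto_comap.congr fun z ↦ ?_)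
  have := congrArg Complex.im (coe_T_smul z)
  simpa using this.symm

lemma tendsto_H₃ : Tendsto H₃ atImInfty (𝓝 1) := by
  have h := isBigO_at_im_infty_jacobiTheta_sub_one.comp_tendsto tendsto_coe_atImInfty
  have h0 : Tendsto (fun z : ℍ ↦ rexp (-π * z.im)) atImInfty (𝓝 0) := by
    refine Real.tendsto_exp_atBot.comp ?_
    exact tendsto_comap.const_mul_atTop_of_neg (neg_lt_zero.mpr Real.pi_pos)
  have h1 : Tendsto (fun z : ℍ ↦ theta3 z - 1) atImInfty (𝓝 0) := h.trans_tendsto h0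
  simpa [H₃] using! ((tendsto_sub_nhds_zero_iff.mp h1).pow 4)

lemma tendsto_H₄ : Tendsto H₄ atImInfty (𝓝 1) :=
  H₄_eq_comp ▸ tendsto_H₃.comp tendsto_T_smul_atImInfty

/-- The exponent `n(n+1)` vanishes only for `n = 0, -1`; once `Im z ≥ 1` the terms are dominated by
their size at `z = i`. -/
lemma tendsto_tsum_theta2 :
    Tendsto (fun z : ℍ ↦ ∑' n : ℤ, exp (π * I * ((n : ℂ) * (n + 1)) * z)) atImInfty (𝓝 2) := by
  have hsum : Summable fun n : ℤ ↦ rexp (-π * ((n : ℝ) * (n + 1))) := by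
    have h := ((summable_jacobiTheta₂_term_iff (I / 2) I).mpr (by simp)).norm
    refine h.congr fun n ↦ ?_
    rw [norm_jacobiTheta₂_term]
    congr 1
    simp; ring
  have hn (n : ℤ) (z : ℍ) : ‖exp (π * I * ((n : ℂ) * (n + 1)) * z)‖ =
      rexp (-π * ((n : ℝ) * (n + 1)) * z.im) := by
    rw [Complex.norm_exp]
    congr 1
    rw [show π * I * ((n : ℂ) * (n + 1)) * z = ((π * ((n : ℝ) * (n + 1)) : ℝ) : ℂ) * (I * z) by
      push_cast; ring, re_ofReal_mul]
    simp
  have hpos (n : ℤ) : (0 : ℝ) ≤ (n : ℝ) * (n + 1) := by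
    have : 0 ≤ n * (n + 1) := by
      rcases le_or_gt 0 n with h | h
      · positivity
      · exact mul_nonneg_of_nonpos_of_nonpos h.le (by omega)
    exact_mod_cast this
  have key := tendsto_tsum_of_dominated_convergence (𝓕 := atImInfty)
    (f := fun (z : ℍ) (n : ℤ) ↦ exp (π * I * ((n : ℂ) * (n + 1)) * z))
    (g := fun n ↦ if n ∈ ({0, -1} : Finset ℤ) then 1 else 0) hsum (fun n ↦ ?_) ?_
  · rw [tsum_eq_sum (s := {0, -1}) (fun n hn ↦ if_neg hn)] at key
    convert key using 2
    rw [Finset.sum_pair (by norm_num)]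
    norm_num
  · split_ifs with h
    · have : (n : ℂ) * (n + 1) = 0 := by
        rcases Finset.mem_insert.mp h with rfl | h
        · simp
        · rw [Finset.mem_singleton.mp h]; norm_num
      simp [this]
    · refine tendsto_zero_iff_norm_tendsto_zero.mpr ?_
      simp_rw [hn]
      refine Real.tendsto_exp_atBot.comp (tendsto_comap.const_mul_atTop_of_neg ?_)
      have : n * (n + 1) ≠ 0 := by
        simp only [Finset.mem_insert, Finset.mem_singleton, not_or] at h
        exact mul_ne_zero h.1 (by omega)
      have : (n : ℝ) * (n + 1) ≠ 0 := mod_cast this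
      nlinarith [Real.pi_pos, mul_pos Real.pi_pos ((hpos n).lt_of_ne' this)]
  · filter_upwards [(tendsto_comap (f := UpperHalfPlane.im)).eventually_ge_atTop 1] with z hz n
    rw [hn]
    rw [Real.exp_le_exp, neg_mul, neg_mul, neg_le_neg_iff]
    exact le_mul_of_one_le_right (mul_nonneg Real.pi_pos.le (hpos n)) hz

lemma norm_H₂ (z : ℍ) : ‖H₂ z‖ =
    rexp (-π * z.im) * ‖∑' n : ℤ, exp (π * I * ((n : ℂ) * (n + 1)) * z)‖ ^ 4 := by
  rw [H₂, theta2, mul_pow, norm_mul, norm_pow, norm_pow, Complex.norm_exp, ← Real.exp_nat_mul]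
  congr 2
  simp only [mul_assoc, mul_div_assoc, re_ofReal_mul, I_mul_re]
  simp; ring

/-- `Θ₂⁴` vanishes at infinity to no more than first order in `q^{1/2}`, which makes division by it
possible. -/
lemma exp_isBigO_H₂ : (fun z : ℍ ↦ rexp (-π * z.im)) =O[atImInfty] H₂ := by
  have h := (tendsto_tsum_theta2.norm.pow 4).eventually_const_le (u := 1) (by norm_num)
  refine .of_bound 1 (h.mono fun z hz ↦ ?_)
  rw [one_mul, norm_H₂, Real.norm_of_nonneg (Real.exp_pos _).le]
  exact le_mul_of_one_le_right (Real.exp_pos _).le hz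

lemma tendsto_H₂ : Tendsto H₂ atImInfty (𝓝 0) := by
  refine tendsto_zero_iff_norm_tendsto_zero.mpr ?_
  simp_rw [norm_H₂]
  have h0 : Tendsto (fun z : ℍ ↦ rexp (-π * z.im)) atImInfty (𝓝 0) :=
    Real.tendsto_exp_atBot.comp
      (tendsto_comap.const_mul_atTop_of_neg (neg_lt_zero.mpr Real.pi_pos))
  simpa using h0.mul (tendsto_tsum_theta2.norm.pow 4)

lemma eventually_H₂_ne_zero : ∀ᶠ z in atImInfty, H₂ z ≠ 0 := by
  have h := (tendsto_tsum_theta2.norm.pow 4).eventually_const_le (u := 1) (by norm_num)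
  refine h.mono fun z hz ↦ norm_pos_iff.mp ?_
  rw [norm_H₂]
  exact mul_pos (Real.exp_pos _) (one_pos.trans_le hz)

end Theta

/-! ### The action of `SL(2, ℤ)` on the fourth powers. -/

section SL2Action

open UpperHalfPlane hiding I
open Complex Filter Topology ModularGroup ModularForm CongruenceSubgroup Matrix
open scoped Real Manifold MatrixGroups

/-- The fourth powers of the theta functions with signs, indexed by the nonzero vectors of
`(ZMod 2)²`. -/
noncomputable def thetaForm (v : Fin 2 → ZMod 2) : ℍ → ℂ :=
  -- The minus sign at `Θ₃⁴` makes the sign in the action independent of `v`.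
  if v = ![0, 1] then H₂ else if v = ![1, 1] then -H₃ else if v = ![1, 0] then H₄ else 0

lemma thetaForm_zero_one : thetaForm ![0, 1] = H₂ := if_pos rfl

lemma thetaForm_one_one : thetaForm ![1, 1] = -H₃ := by
  rw [thetaForm, if_neg (by decide), if_pos rfl]

lemma thetaForm_one_zero : thetaForm ![1, 0] = H₄ := by
  rw [thetaForm, if_neg (by decide), if_neg (by decide), if_pos rfl]

lemma thetaForm_zero : thetaForm ![0, 0] = 0 := by
  rw [thetaForm, if_neg (by decide), if_neg (by decide), if_neg (by decide)]

lemma eq_of_vec_zmod_two (v : Fin 2 → ZMod 2) :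
    v = ![0, 0] ∨ v = ![0, 1] ∨ v = ![1, 1] ∨ v = ![1, 0] := by
  revert v; decide

/-- The sign of the permutation of the nonzero vectors of `(ZMod 2)²` given by a matrix. -/
def sl2Sign (A : Matrix (Fin 2) (Fin 2) (ZMod 2)) : ℤ :=
  -- For determinant one, the even elements are those of order three (trace `1`) and the identity.
  if A 0 0 + A 1 1 = 1 ∨ A 0 1 = 0 ∧ A 1 0 = 0 then 1 else -1

lemma sl2Sign_mul {A B : Matrix (Fin 2) (Fin 2) (ZMod 2)} (hA : A.det = 1) (hB : B.det = 1) :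
    sl2Sign (A * B) = sl2Sign A * sl2Sign B := by
  have key : ∀ a b c d e f g h : ZMod 2, a * d - b * c = 1 → e * h - f * g = 1 →
      (if (a * e + b * g) + (c * f + d * h) = 1 ∨ a * f + b * h = 0 ∧ c * e + d * g = 0 then 1
        else -1 : ℤ) = (if a + d = 1 ∨ b = 0 ∧ c = 0 then 1 else -1) *
          (if e + h = 1 ∨ f = 0 ∧ g = 0 then 1 else -1) := by
    decide
  rw [det_fin_two] at hA hB
  simpa [sl2Sign, mul_apply, Fin.sum_univ_two] using key _ _ _ _ _ _ _ _ hA hB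

lemma sl2Sign_eq (A : Matrix (Fin 2) (Fin 2) (ZMod 2)) : sl2Sign A = 1 ∨ sl2Sign A = -1 := by
  rw [sl2Sign]; split_ifs <;> simp

/-- Reduction modulo two. -/
abbrev redTwo (γ : SL(2, ℤ)) : Matrix (Fin 2) (Fin 2) (ZMod 2) :=
  (SpecialLinearGroup.map (Int.castRingHom (ZMod 2)) γ : SL(2, ZMod 2))

lemma det_redTwo (γ : SL(2, ℤ)) : (redTwo γ).det = 1 := Matrix.SpecialLinearGroup.det_coe _

lemma redTwo_mul (γ δ : SL(2, ℤ)) : redTwo (γ * δ) = redTwo γ * redTwo δ := by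
  simp [redTwo]

lemma slash_S_apply (k : ℤ) (f : ℍ → ℂ) (z : ℍ) :
    (f ∣[k] S) z = f (S • z) * (z : ℂ) ^ (-k) := by
  rw [SL_slash_apply, denom_S]

lemma slash_T_apply (k : ℤ) (f : ℍ → ℂ) (z : ℍ) : (f ∣[k] T) z = f (T • z) := by
  have h : denom (T : SL(2, ℤ)) z = 1 := by rw [ModularGroup.denom_apply]; simp [T]
  rw [SL_slash_apply, h, _root_.one_zpow, mul_one]

lemma H₂_slash_S : H₂ ∣[(2 : ℤ)] S = -H₄ := by
  ext z
  rw [slash_S_apply, H₂_S_smul, Pi.neg_apply]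
  field_simp [z.ne_zero]

lemma H₃_slash_S : H₃ ∣[(2 : ℤ)] S = -H₃ := by
  ext z
  rw [slash_S_apply, H₃_S_smul, Pi.neg_apply]
  field_simp [z.ne_zero]

lemma H₄_slash_S : H₄ ∣[(2 : ℤ)] S = -H₂ := by
  ext z
  rw [slash_S_apply, H₄_S_smul, Pi.neg_apply]
  field_simp [z.ne_zero]

lemma H₂_slash_T : H₂ ∣[(2 : ℤ)] T = -H₂ := by
  ext z; rw [slash_T_apply, H₂_T_smul, Pi.neg_apply]

lemma H₃_slash_T : H₃ ∣[(2 : ℤ)] T = H₄ := by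
  ext z; rw [slash_T_apply, H₃_T_smul]

lemma H₄_slash_T : H₄ ∣[(2 : ℤ)] T = H₃ := by
  ext z; rw [slash_T_apply, H₄_T_smul]

/-- Every element of `SL(2, ℤ)` permutes the functions `thetaForm v` up to a common sign. -/
lemma thetaForm_slash (γ : SL(2, ℤ)) (v : Fin 2 → ZMod 2) :
    thetaForm v ∣[(2 : ℤ)] γ = (sl2Sign (redTwo γ) : ℂ) • thetaForm (v ᵥ* redTwo γ) := by
  have hγ : γ ∈ Subgroup.closure {S, T} := by simp [SpecialLinearGroup.SL2Z_generators]
  induction hγ using Subgroup.closure_induction generalizing v with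
  | mem x hx =>
    rcases hx with rfl | hx
    · have hs : redTwo S = !![0, 1; 1, 0] := by decide
      have hsg : sl2Sign (redTwo S) = -1 := by decide
      rw [hsg, hs]
      rcases eq_of_vec_zmod_two v with rfl | rfl | rfl | rfl
      · rw [show ![0, 0] ᵥ* !![0, 1; 1, 0] = (![0, 0] : Fin 2 → ZMod 2) by decide]
        simp [thetaForm_zero]
      · rw [show ![0, 1] ᵥ* !![0, 1; 1, 0] = (![1, 0] : Fin 2 → ZMod 2) by decide]
        simp [thetaForm_zero_one, thetaForm_one_zero, H₂_slash_S]
      · rw [show ![1, 1] ᵥ* !![0, 1; 1, 0] = (![1, 1] : Fin 2 → ZMod 2) by decide]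
        simp [thetaForm_one_one, H₃_slash_S]
      · rw [show ![1, 0] ᵥ* !![0, 1; 1, 0] = (![0, 1] : Fin 2 → ZMod 2) by decide]
        simp [thetaForm_zero_one, thetaForm_one_zero, H₄_slash_S]
    · rw [Set.mem_singleton_iff.mp hx]
      have hs : redTwo T = !![1, 1; 0, 1] := by decide
      have hsg : sl2Sign (redTwo T) = -1 := by decide
      rw [hsg, hs]
      rcases eq_of_vec_zmod_two v with rfl | rfl | rfl | rfl
      · rw [show ![0, 0] ᵥ* !![1, 1; 0, 1] = (![0, 0] : Fin 2 → ZMod 2) by decide]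
        simp [thetaForm_zero]
      · rw [show ![0, 1] ᵥ* !![1, 1; 0, 1] = (![0, 1] : Fin 2 → ZMod 2) by decide]
        simp [thetaForm_zero_one, H₂_slash_T]
      · rw [show ![1, 1] ᵥ* !![1, 1; 0, 1] = (![1, 0] : Fin 2 → ZMod 2) by decide]
        simp [thetaForm_one_one, thetaForm_one_zero, H₃_slash_T]
      · rw [show ![1, 0] ᵥ* !![1, 1; 0, 1] = (![1, 1] : Fin 2 → ZMod 2) by decide]
        simp [thetaForm_one_one, thetaForm_one_zero, H₄_slash_T]
  | one =>
    rw [show redTwo 1 = 1 by simp [redTwo], vecMul_one, show sl2Sign 1 = 1 by decide]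
    simp
  | mul x y _ _ hx hy =>
    rw [SlashAction.slash_mul, hx, SL_smul_slash, hy, redTwo_mul,
      sl2Sign_mul (det_redTwo x) (det_redTwo y), vecMul_vecMul, smul_smul, Int.cast_mul]
  | inv x _ hx =>
    have h1 : redTwo x⁻¹ * redTwo x = 1 := by rw [← redTwo_mul]; simp [redTwo]
    have h2 : sl2Sign (redTwo x⁻¹) * sl2Sign (redTwo x) = 1 := by
      rw [← sl2Sign_mul (det_redTwo _) (det_redTwo _), h1]; decide
    have h3 := congrArg (· ∣[(2 : ℤ)] x⁻¹) (hx (v ᵥ* redTwo x⁻¹))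
    simp only [← SlashAction.slash_mul, mul_inv_cancel, SlashAction.slash_one, vecMul_vecMul, h1,
      vecMul_one, SL_smul_slash] at h3
    rw [h3, smul_smul, ← Int.cast_mul, h2]
    simp

lemma redTwo_of_mem_Gamma {γ : SL(2, ℤ)} (h : γ ∈ CongruenceSubgroup.Gamma 2) : redTwo γ = 1 := by
  rw [redTwo, Gamma_mem'.mp h]; rfl

lemma thetaForm_slash_of_mem_Gamma {γ : SL(2, ℤ)} (h : γ ∈ CongruenceSubgroup.Gamma 2) (v : Fin 2 → ZMod 2) :
    thetaForm v ∣[(2 : ℤ)] γ = thetaForm v := by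
  rw [thetaForm_slash, redTwo_of_mem_Gamma h, vecMul_one, show sl2Sign 1 = 1 by decide]
  simp

lemma mdifferentiable_thetaForm (v : Fin 2 → ZMod 2) : MDiff (thetaForm v) := by
  rcases eq_of_vec_zmod_two v with rfl | rfl | rfl | rfl
  · rw [thetaForm_zero]; exact mdifferentiable_const
  · rw [thetaForm_zero_one]; exact mdifferentiable_H₂
  · rw [thetaForm_one_one]; exact mdifferentiable_H₃.neg
  · rw [thetaForm_one_zero]; exact mdifferentiable_H₄

/-- The value of `thetaForm v` at infinity. -/
def thetaFormValue (v : Fin 2 → ZMod 2) : ℤ :=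
  if v = ![1, 1] then -1 else if v = ![1, 0] then 1 else 0

lemma tendsto_thetaForm (v : Fin 2 → ZMod 2) :
    Tendsto (thetaForm v) atImInfty (𝓝 (thetaFormValue v)) := by
  rcases eq_of_vec_zmod_two v with rfl | rfl | rfl | rfl
  · rw [thetaForm_zero, show thetaFormValue ![0, 0] = 0 by decide]
    simpa using! tendsto_const_nhds
  · rw [thetaForm_zero_one, show thetaFormValue ![0, 1] = 0 by decide]
    simpa using tendsto_H₂
  · rw [thetaForm_one_one, show thetaFormValue ![1, 1] = -1 by decide]
    rw [Int.cast_neg, Int.cast_one]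
    exact tendsto_H₃.neg
  · rw [thetaForm_one_zero, show thetaFormValue ![1, 0] = 1 by decide]
    simpa using tendsto_H₄

end SL2Action

/-! ### Level one: Jacobi's identity, nonvanishing of the thetas and of `λ'`. -/

section LevelOne

open UpperHalfPlane hiding I
open Complex Filter Topology ModularGroup ModularForm Derivative SlashInvariantForm
open scoped Real Manifold MatrixGroups

lemma exists_levelOne_cuspForm {k : ℤ} {f : ℍ → ℂ} (hS : f ∣[k] S = f) (hT : f ∣[k] T = f)
    (hf : MDiff f) (h0 : IsZeroAtImInfty f) : ∃ g : CuspForm 𝒮ℒ k, ⇑g = f :=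
  ⟨{ toFun := f
     slash_action_eq' := by
       rintro _ ⟨A, rfl⟩
       exact slash_action_generators_SL2Z hS hT A
     holo' := hf
     zero_at_cusps' := fun hc ↦ by
       rw [Subgroup.IsArithmetic.isCusp_iff_isCusp_SL2Z] at hc
       rw [OnePoint.isZeroAt_iff_forall_SL2Z hc]
       intro γ _
       rwa [slash_action_generators_SL2Z hS hT] }, rfl⟩

lemma eq_zero_of_levelOne_weight_four {f : ℍ → ℂ} (hS : f ∣[(4 : ℤ)] S = f)
    (hT : f ∣[(4 : ℤ)] T = f) (hf : MDiff f) (h0 : IsZeroAtImInfty f) : f = 0 := by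
  obtain ⟨g, rfl⟩ := exists_levelOne_cuspForm hS hT hf h0
  have := rank_zero_iff_forall_zero.mp (CuspForm.rank_eq_zero_of_weight_lt_twelve
    (show (4 : ℤ) < 12 by norm_num)) g
  rw [this]; rfl

lemma ne_zero_of_levelOne_weight_twelve {f : ℍ → ℂ} (hS : f ∣[(12 : ℤ)] S = f)
    (hT : f ∣[(12 : ℤ)] T = f) (hf : MDiff f) (h0 : IsZeroAtImInfty f) (hne : f ≠ 0) (z : ℍ) :
    f z ≠ 0 := by
  obtain ⟨g, rfl⟩ := exists_levelOne_cuspForm hS hT hf h0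
  obtain ⟨c, rfl⟩ := CuspForm.exists_smul_discriminant_of_weight_eq_twelve g
  have hc : c ≠ 0 := by rintro rfl; exact hne (by ext; simp)
  exact mul_ne_zero hc (discriminant_ne_zero z)

/-- A form of weight six for the sign character of `SL(2, ℤ)` that vanishes at infinity has no
zeros. -/
lemma ne_zero_of_weight_six {f : ℍ → ℂ} (hS : f ∣[(6 : ℤ)] S = -f) (hT : f ∣[(6 : ℤ)] T = -f)
    (hf : MDiff f) (h0 : IsZeroAtImInfty f) (hne : f ≠ 0) (z : ℍ) : f z ≠ 0 := by
  have key (γ : SL(2, ℤ)) (h : f ∣[(6 : ℤ)] γ = -f) : (f * f) ∣[(12 : ℤ)] γ = f * f := by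
    rw [show (12 : ℤ) = 6 + 6 by norm_num, mul_slash_SL2, h, neg_mul_neg]
  have h00 : IsZeroAtImInfty (f * f) := by
    simpa using! Tendsto.mul h0 h0
  exact left_ne_zero_of_mul (ne_zero_of_levelOne_weight_twelve (key S hS) (key T hT) (hf.mul hf) h00
    (fun h ↦ hne (by simpa using! (mul_eq_zero_iff hf hf).mp h)) z)

/-- Jacobi's identity `Θ₃⁴ = Θ₂⁴ + Θ₄⁴`. -/
theorem H₃_eq_add : H₃ = H₂ + H₄ := by
  set J : ℍ → ℂ := H₃ - H₂ - H₄ with hJ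
  have hd : MDiff J := (mdifferentiable_H₃.sub mdifferentiable_H₂).sub mdifferentiable_H₄
  have h0 : Tendsto J atImInfty (𝓝 0) := by
    simpa using! (tendsto_H₃.sub tendsto_H₂).sub tendsto_H₄
  -- `J` is invariant only up to sign, so its square is used: a level one cusp form of weight four,
  -- hence zero.
  have key (γ : SL(2, ℤ)) (h : J ∣[(2 : ℤ)] γ = J ∨ J ∣[(2 : ℤ)] γ = -J) :
      (J * J) ∣[(4 : ℤ)] γ = J * J := by
    rw [show (4 : ℤ) = 2 + 2 by norm_num, mul_slash_SL2]
    rcases h with h | h <;> rw [h]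
    exact neg_mul_neg _ _
  have hS : J ∣[(2 : ℤ)] S = -J := by
    rw [hJ, sub_eq_add_neg, sub_eq_add_neg]
    simp only [SlashAction.add_slash, SlashAction.neg_slash, H₂_slash_S, H₃_slash_S, H₄_slash_S]
    abel
  have hT : J ∣[(2 : ℤ)] T = -J := by
    rw [hJ, sub_eq_add_neg, sub_eq_add_neg]
    simp only [SlashAction.add_slash, SlashAction.neg_slash, H₂_slash_T, H₃_slash_T, H₄_slash_T]
    abel
  have hJJ := eq_zero_of_levelOne_weight_four (key S (.inr hS)) (key T (.inr hT)) (hd.mul hd)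
    (by simpa using! Tendsto.mul h0 h0)
  have hJ0 : J = 0 := by simpa using! (mul_eq_zero_iff hd hd).mp hJJ
  rwa [hJ, sub_sub, sub_eq_zero] at hJ0

lemma H₂_mul_H₃_mul_H₄_ne_zero (z : ℍ) : H₂ z * H₃ z * H₄ z ≠ 0 := by
  have key (γ : SL(2, ℤ)) : (H₂ * H₃ * H₄) ∣[(6 : ℤ)] γ =
      H₂ ∣[(2 : ℤ)] γ * H₃ ∣[(2 : ℤ)] γ * H₄ ∣[(2 : ℤ)] γ := by
    rw [show (6 : ℤ) = 2 + 2 + 2 by norm_num, mul_slash_SL2, mul_slash_SL2]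
  refine ne_zero_of_weight_six (f := H₂ * H₃ * H₄) ?_ ?_
    ((mdifferentiable_H₂.mul mdifferentiable_H₃).mul mdifferentiable_H₄) ?_ ?_ z
  · rw [key, H₂_slash_S, H₃_slash_S, H₄_slash_S]; ring
  · rw [key, H₂_slash_T, H₃_slash_T, H₄_slash_T]; ring
  · simpa using! (tendsto_H₂.mul tendsto_H₃).mul tendsto_H₄
  · intro h
    obtain ⟨w, h2, h3, h4⟩ := (eventually_H₂_ne_zero.and
      ((tendsto_H₃.eventually_ne one_ne_zero).and (tendsto_H₄.eventually_ne one_ne_zero))).exists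
    exact mul_ne_zero (mul_ne_zero h2 h3) h4 (congrFun h w)

lemma H₂_ne_zero (z : ℍ) : H₂ z ≠ 0 :=
  left_ne_zero_of_mul (left_ne_zero_of_mul (H₂_mul_H₃_mul_H₄_ne_zero z))

lemma H₃_ne_zero (z : ℍ) : H₃ z ≠ 0 :=
  right_ne_zero_of_mul (left_ne_zero_of_mul (H₂_mul_H₃_mul_H₄_ne_zero z))

lemma H₄_ne_zero (z : ℍ) : H₄ z ≠ 0 :=
  right_ne_zero_of_mul (H₂_mul_H₃_mul_H₄_ne_zero z)

lemma lambdaFn_eq : lambdaFn = fun z ↦ H₂ z / H₃ z := rfl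

lemma mdifferentiable_lambdaFn : MDiff lambdaFn := by
  rw [UpperHalfPlane.mdifferentiable_iff]
  exact (UpperHalfPlane.mdifferentiable_iff.mp mdifferentiable_H₂).div (UpperHalfPlane.mdifferentiable_iff.mp mdifferentiable_H₃)
    fun z _ ↦ H₃_ne_zero _

lemma tendsto_lambdaFn : Tendsto lambdaFn atImInfty (𝓝 0) := by
  simpa using! tendsto_H₂.div tendsto_H₃ one_ne_zero

lemma lambdaFn_ne_zero (z : ℍ) : lambdaFn z ≠ 0 := div_ne_zero (H₂_ne_zero z) (H₃_ne_zero z)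

lemma one_sub_lambdaFn (z : ℍ) : 1 - lambdaFn z = H₄ z / H₃ z := by
  have h := congrFun H₃_eq_add z
  rw [lambdaFn_eq, one_sub_div (H₃_ne_zero z), h, Pi.add_apply, add_sub_cancel_left]

lemma lambdaFn_ne_one (z : ℍ) : lambdaFn z ≠ 1 := fun h ↦ by
  have h1 := one_sub_lambdaFn z
  rw [h, sub_self] at h1
  exact div_ne_zero (H₄_ne_zero z) (H₃_ne_zero z) h1.symm

lemma lambdaFn_S_smul (z : ℍ) : lambdaFn (S • z) = 1 - lambdaFn z := by
  have := z.ne_zero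
  have := H₃_ne_zero z
  rw [one_sub_lambdaFn, lambdaFn_eq]
  simp only [H₂_S_smul, H₃_S_smul]
  field_simp

lemma lambdaFn_T_smul (z : ℍ) : lambdaFn (T • z) = lambdaFn z / (lambdaFn z - 1) := by
  have h3 := H₃_ne_zero z
  have h4 := H₄_ne_zero z
  rw [← neg_sub 1 (lambdaFn z), one_sub_lambdaFn, lambdaFn_eq]
  simp only [H₂_T_smul, H₃_T_smul]
  field_simp

/-- The Wronskian of two functions on the upper half-plane. -/
noncomputable def wronskianD (F G : ℍ → ℂ) : ℍ → ℂ := D F * G - F * D G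

/-- The non-modular terms in the transformation of `D F` and `D G` cancel. -/
lemma wronskianD_slash {k : ℤ} {F G : ℍ → ℂ} (hF : MDiff F) (hG : MDiff G) (γ : SL(2, ℤ)) :
    wronskianD F G ∣[k + 2 + k] γ = wronskianD (F ∣[k] γ) (G ∣[k] γ) := by
  rw [wronskianD, wronskianD, normalizedDerivOfComplex_SL_slash hF,
    normalizedDerivOfComplex_SL_slash hG, sub_eq_add_neg, SlashAction.add_slash,
    SlashAction.neg_slash, mul_slash_SL2, show k + 2 + k = k + (k + 2) by ring, mul_slash_SL2]
  ext z
  simp only [Pi.add_apply, Pi.mul_apply, Pi.sub_apply, Pi.neg_apply]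
  ring

/-- Cauchy's estimate on the disc of radius `Im z / 2` around `z`. -/
lemma isZeroAtImInfty_normalizedDeriv {f : ℍ → ℂ} (hf : MDiff f) (hb : IsBoundedAtImInfty f) :
    IsZeroAtImInfty (D f) := by
  obtain ⟨M, A, hM⟩ := isBoundedAtImInfty_iff.mp hb
  have hdiff := UpperHalfPlane.mdifferentiable_iff.mp hf
  have key (z : ℍ) (hz : 2 * A ≤ z.im) : ‖deriv (f ∘ ofComplex) z‖ ≤ M / (z.im / 2) := by
    have him (w : ℂ) (hw : w ∈ Metric.closedBall (z : ℂ) (z.im / 2)) : z.im / 2 ≤ w.im := by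
      have h1 := (Complex.abs_im_le_norm (w - z)).trans (mem_closedBall_iff_norm.mp hw)
      rw [Complex.sub_im, coe_im] at h1
      linarith [(abs_le.mp h1).1]
    refine norm_deriv_le_of_forall_mem_sphere_norm_le (half_pos z.im_pos) ?_ fun w hw ↦ ?_
    · refine (hdiff.mono fun w hw ↦ ?_).diffContOnCl
      rw [closure_ball _ (half_pos z.im_pos).ne'] at hw
      exact (half_pos z.im_pos).trans_le (him w hw)
    · have h2 := him w (Metric.sphere_subset_closedBall hw)
      have h3 := (half_pos z.im_pos).trans_le h2
      rw [Function.comp_apply, ofComplex_apply_of_im_pos h3]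
      exact hM _ (by change A ≤ w.im; linarith)
  refine squeeze_zero_norm' (a := fun z : ℍ ↦ ‖(2 * π * I : ℂ)⁻¹‖ * (M / (z.im / 2))) ?_ ?_
  · filter_upwards [tendsto_comap.eventually_ge_atTop (2 * A)] with z hz
    rw [normalizedDerivOfComplex, norm_mul]
    exact mul_le_mul_of_nonneg_left (key z hz) (norm_nonneg _)
  · have h1 : Tendsto (fun z : ℍ ↦ z.im / 2) atImInfty atTop :=
      tendsto_comap.atTop_div_const two_pos
    simpa using (h1.const_div_atTop M).const_mul ‖(2 * π * I : ℂ)⁻¹‖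

lemma deriv_lambdaFn (z : ℍ) : deriv (lambdaFn ∘ ofComplex) z =
    2 * π * I * wronskianD H₂ H₃ z / H₃ z ^ 2 := by
  have h2 := UpperHalfPlane.mdifferentiableAt_iff.mp (mdifferentiable_H₂ z)
  have h3 := UpperHalfPlane.mdifferentiableAt_iff.mp (mdifferentiable_H₃ z)
  have := two_pi_I_ne_zero
  rw [show lambdaFn ∘ ofComplex = (H₂ ∘ ofComplex) / (H₃ ∘ ofComplex) from rfl,
    deriv_div h2 h3 (H₃_ne_zero _)]
  simp only [wronskianD, Pi.sub_apply, Pi.mul_apply, normalizedDerivOfComplex, Function.comp_apply,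
    ofComplex_apply]
  congr 1
  field_simp

/-- By Jacobi's identity, replacing `H₃` by `H₄` leaves the Wronskian unchanged, so `S` and `T` act
on it by the sign character. -/
lemma wronskianD_H₂_H₃_ne_zero (z : ℍ) : wronskianD H₂ H₃ z ≠ 0 := by
  have hneg (F : ℍ → ℂ) (hF : MDiff F) : D (-F) = -D F := normalizedDerivOfComplex_neg F hF
  have hadd : D H₃ = D H₂ + D H₄ := by
    rw [H₃_eq_add, normalizedDerivOfComplex_add _ _ mdifferentiable_H₂ mdifferentiable_H₄]
  refine ne_zero_of_weight_six (f := wronskianD H₂ H₃) ?_ ?_ ?_ ?_ ?_ z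
  · rw [show (6 : ℤ) = 2 + 2 + 2 by norm_num,
      wronskianD_slash mdifferentiable_H₂ mdifferentiable_H₃, H₂_slash_S, H₃_slash_S, wronskianD,
      wronskianD, hneg _ mdifferentiable_H₄, hneg _ mdifferentiable_H₃, hadd, H₃_eq_add]
    ring
  · rw [show (6 : ℤ) = 2 + 2 + 2 by norm_num,
      wronskianD_slash mdifferentiable_H₂ mdifferentiable_H₃, H₂_slash_T, H₃_slash_T, wronskianD,
      wronskianD, hneg _ mdifferentiable_H₂, hadd, H₃_eq_add]
    ring
  · exact ((normalizedDerivOfComplex_mdifferentiable mdifferentiable_H₂).mul mdifferentiable_H₃).sub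
      (mdifferentiable_H₂.mul (normalizedDerivOfComplex_mdifferentiable mdifferentiable_H₃))
  · have h2 := isZeroAtImInfty_normalizedDeriv mdifferentiable_H₂ (tendsto_H₂.isBigO_one ℝ)
    have h3 := isZeroAtImInfty_normalizedDeriv mdifferentiable_H₃ (tendsto_H₃.isBigO_one ℝ)
    simpa using! (Tendsto.mul h2 tendsto_H₃).sub (tendsto_H₂.mul h3)
  -- Otherwise `λ` would be constant, equal to its limit `0` at infinity.
  · intro h
    have hd0 : ∀ w ∈ upperHalfPlaneSet, deriv (lambdaFn ∘ ofComplex) w = 0 := fun w hw ↦ by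
      simpa [h] using deriv_lambdaFn ⟨w, hw⟩
    obtain ⟨c, hc⟩ := isOpen_upperHalfPlaneSet.exists_is_const_of_deriv_eq_zero
      (convex_halfSpace_im_gt 0).isPreconnected (UpperHalfPlane.mdifferentiable_iff.mp mdifferentiable_lambdaFn) hd0
    have hconst (w : ℍ) : lambdaFn w = c := by simpa using hc w w.im_pos
    have hc0 : c = 0 := tendsto_nhds_unique (tendsto_const_nhds.congr fun w ↦ (hconst w).symm)
      tendsto_lambdaFn
    exact lambdaFn_ne_zero z ((hconst z).trans hc0)

lemma deriv_lambdaFn_ne_zero (z : ℍ) : deriv (lambdaFn ∘ ofComplex) z ≠ 0 := by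
  rw [deriv_lambdaFn]
  exact div_ne_zero (mul_ne_zero two_pi_I_ne_zero (wronskianD_H₂_H₃_ne_zero z))
    (pow_ne_zero _ (H₃_ne_zero z))

end LevelOne

/-! ### Forms for `Γ(2)` as polynomials in `λ`; surjectivity of `λ`. -/

section GammaTwoForms

open UpperHalfPlane hiding I
open Complex Filter Topology ModularGroup ModularForm Matrix
open scoped Real Manifold MatrixGroups CongruenceSubgroup

/-- Modular forms for `Γ(2)` as plain functions. -/
structure IsGammaTwoForm (k : ℤ) (f : ℍ → ℂ) : Prop where
  slash_eq : ∀ γ ∈ Γ(2), f ∣[k] γ = f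
  holo : MDiff f
  bdd : ∀ γ : SL(2, ℤ), IsBoundedAtImInfty (f ∣[k] γ)

namespace IsGammaTwoForm

variable {k l : ℤ} {f g : ℍ → ℂ}

lemma exists_modularForm (hf : IsGammaTwoForm k f) : ∃ g : ModularForm Γ(2) k, ⇑g = f :=
  ⟨{ toFun := f
     slash_action_eq' := by
       rintro _ ⟨A, hA, rfl⟩
       exact hf.slash_eq A hA
     holo' := hf.holo
     bdd_at_cusps' := fun hc ↦ by
       rw [Subgroup.IsArithmetic.isCusp_iff_isCusp_SL2Z] at hc
       rw [OnePoint.isBoundedAt_iff_forall_SL2Z hc]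
       exact fun γ _ ↦ hf.bdd γ }, rfl⟩

lemma eq_zero_of_neg (hf : IsGammaTwoForm k f) (hk : k < 0) : f = 0 := by
  obtain ⟨g, rfl⟩ := hf.exists_modularForm
  rw [ModularForm.isZero_of_neg_weight hk g]; rfl

lemma eq_const (hf : IsGammaTwoForm 0 f) : ∃ c, f = Function.const ℍ c := by
  obtain ⟨g, rfl⟩ := hf.exists_modularForm
  exact ModularForm.eq_const_of_weight_zero g

lemma periodic (hf : IsGammaTwoForm k f) : Function.Periodic (f ∘ ofComplex) (2 : ℝ) := by
  obtain ⟨g, rfl⟩ := hf.exists_modularForm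
  exact SlashInvariantFormClass.periodic_comp_ofComplex g (by simp)

lemma bdd_infty (hf : IsGammaTwoForm k f) : IsBoundedAtImInfty f := by simpa using hf.bdd 1

lemma exists_tendsto (hf : IsGammaTwoForm k f) : ∃ a, Tendsto f atImInfty (𝓝 a) := by
  have h := (analyticAt_cuspFunction_zero two_pos hf.periodic hf.holo hf.bdd_infty).continuousAt
  refine ⟨_, (h.tendsto.comp (qParam_tendsto_atImInfty two_pos)).congr fun z ↦ ?_⟩
  exact eq_cuspFunction z two_ne_zero hf.periodic

lemma isBigO_exp (hf : IsGammaTwoForm k f) (h0 : IsZeroAtImInfty f) :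
    f =O[atImInfty] fun z ↦ rexp (-π * z.im) := by
  refine (h0.exp_decay_atImInfty two_pos hf.periodic hf.holo hf.bdd_infty).congr_right fun z ↦ ?_
  congr 1; ring

lemma add (hf : IsGammaTwoForm k f) (hg : IsGammaTwoForm k g) : IsGammaTwoForm k (f + g) where
  slash_eq γ hγ := by rw [SlashAction.add_slash, hf.slash_eq γ hγ, hg.slash_eq γ hγ]
  holo := hf.holo.add hg.holo
  bdd γ := by rw [SlashAction.add_slash]; exact (hf.bdd γ).add (hg.bdd γ)

lemma smul (c : ℂ) (hf : IsGammaTwoForm k f) : IsGammaTwoForm k (c • f) where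
  slash_eq γ hγ := by rw [SL_smul_slash, hf.slash_eq γ hγ]
  holo := mdifferentiable_const.mul hf.holo
  bdd γ := by rw [SL_smul_slash]; exact Asymptotics.IsBigO.const_mul_left (hf.bdd γ) c

lemma mul (hf : IsGammaTwoForm k f) (hg : IsGammaTwoForm l g) :
    IsGammaTwoForm (k + l) (f * g) where
  slash_eq γ hγ := by rw [mul_slash_SL2, hf.slash_eq γ hγ, hg.slash_eq γ hγ]
  holo := hf.holo.mul hg.holo
  bdd γ := by
    rw [mul_slash_SL2]
    exact Filter.BoundedAtFilter.mul (hf.bdd γ) (hg.bdd γ)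

end IsGammaTwoForm

lemma isGammaTwoForm_one : IsGammaTwoForm 0 1 where
  slash_eq γ _ := is_invariant_one γ
  holo := mdifferentiable_const
  bdd γ := by rw [is_invariant_one]; exact Filter.const_boundedAtFilter _ _

lemma isGammaTwoForm_thetaForm (v : Fin 2 → ZMod 2) : IsGammaTwoForm 2 (thetaForm v) where
  slash_eq _ hγ := thetaForm_slash_of_mem_Gamma hγ v
  holo := mdifferentiable_thetaForm v
  bdd γ := by
    rw [thetaForm_slash]
    exact ((tendsto_thetaForm _).isBigO_one ℝ).const_mul_left _

lemma isGammaTwoForm_H₂ : IsGammaTwoForm 2 H₂ :=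
  thetaForm_zero_one ▸ isGammaTwoForm_thetaForm _

lemma isGammaTwoForm_H₃ : IsGammaTwoForm 2 H₃ := by
  have := (isGammaTwoForm_thetaForm ![1, 1]).smul (-1)
  rwa [thetaForm_one_one, neg_one_smul, neg_neg] at this

lemma isGammaTwoForm_H₃_pow (n : ℕ) : IsGammaTwoForm (2 * n) (H₃ ^ n) := by
  induction n with
  | zero => simpa using isGammaTwoForm_one
  | succ n ih =>
    rw [pow_succ, Nat.cast_succ, mul_add, mul_one]
    exact ih.mul isGammaTwoForm_H₃

/-- The values of the theta forms at infinity, for distinct nonzero indices, are distinct. -/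
lemma thetaFormValue_add_mul_ne_zero {v w : Fin 2 → ZMod 2} (hv : v ≠ 0) (hw : w ≠ 0)
    (hvw : v ≠ w) {c : ℂ} (h0 : c ≠ 0) (h1 : c ≠ 1) :
    (thetaFormValue v : ℂ) + c * thetaFormValue w ≠ 0 := by
  have key : ∀ v w : Fin 2 → ZMod 2, v ≠ 0 → w ≠ 0 → v ≠ w →
      thetaFormValue v = 0 ∧ thetaFormValue w ^ 2 = 1 ∨
      thetaFormValue v ^ 2 = 1 ∧ thetaFormValue w = 0 ∨
      thetaFormValue v ^ 2 = 1 ∧ thetaFormValue w = -thetaFormValue v := by decide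
  rcases key v w hv hw hvw with ⟨ha, hb⟩ | ⟨ha, hb⟩ | ⟨ha, hb⟩
  · have hb' : (thetaFormValue w : ℂ) ≠ 0 := by
      intro h; rw [Int.cast_eq_zero.mp h] at hb; norm_num at hb
    simp [ha, h0, hb']
  · have ha' : (thetaFormValue v : ℂ) ≠ 0 := by
      intro h; rw [Int.cast_eq_zero.mp h] at ha; norm_num at ha
    simpa [hb] using ha'
  · have ha' : (thetaFormValue v : ℂ) ≠ 0 := by
      intro h; rw [Int.cast_eq_zero.mp h] at ha; norm_num at ha
    rw [hb, Int.cast_neg, show (thetaFormValue v : ℂ) + c * -thetaFormValue v =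
      thetaFormValue v * (1 - c) by ring]
    exact mul_ne_zero ha' (sub_ne_zero.mpr h1.symm)

lemma vecMul_redTwo_injective (γ : SL(2, ℤ)) :
    Function.Injective fun v : Fin 2 → ZMod 2 ↦ v ᵥ* redTwo γ := fun v w h ↦ by
  have h2 := congrArg (· ᵥ* redTwo γ⁻¹) h
  have h1 : redTwo γ * redTwo γ⁻¹ = 1 := by rw [← redTwo_mul]; simp [redTwo]
  simpa only [vecMul_vecMul, h1, vecMul_one] using h2

lemma vecMul_redTwo_ne_zero (γ : SL(2, ℤ)) {v : Fin 2 → ZMod 2} (hv : v ≠ 0) :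
    v ᵥ* redTwo γ ≠ 0 := fun h ↦
  hv (vecMul_redTwo_injective γ (by simpa using h))

lemma sl2Sign_cast_ne_zero (A : Matrix (Fin 2) (Fin 2) (ZMod 2)) : (sl2Sign A : ℂ) ≠ 0 := by
  rcases sl2Sign_eq A with h | h <;> simp [h]

/-- The function `λ` takes every value other than `0` and `1`. -/
theorem exists_lambdaFn_eq {c : ℂ} (h0 : c ≠ 0) (h1 : c ≠ 1) : ∃ z, lambdaFn z = c := by
  by_contra! hc
  set g : ℍ → ℂ := thetaForm ![0, 1] + c • thetaForm ![1, 1] with hg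
  have hgform : IsGammaTwoForm 2 g :=
    (isGammaTwoForm_thetaForm _).add ((isGammaTwoForm_thetaForm _).smul c)
  have hgz (z : ℍ) : g z ≠ 0 := fun h ↦ by
    refine hc z ?_
    rw [hg, thetaForm_zero_one, thetaForm_one_one] at h
    rw [lambdaFn_eq, div_eq_iff (H₃_ne_zero z)]
    simpa [← sub_eq_add_neg, sub_eq_zero] using h
  have hform : IsGammaTwoForm (0 - 2) (1 / g) :=
    { slash_eq := fun γ hγ ↦ by rw [div_slash_SL2, is_invariant_one, hgform.slash_eq γ hγ]
      holo := (mdifferentiable_const (c := (1 : ℂ))).div hgform.holo hgz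
      bdd := fun γ ↦ by
        rw [div_slash_SL2, is_invariant_one, hg, SlashAction.add_slash, SL_smul_slash,
          thetaForm_slash, thetaForm_slash, smul_comm, ← smul_add]
        have hlim := ((tendsto_thetaForm (![0, 1] ᵥ* redTwo γ)).add
          ((tendsto_thetaForm (![1, 1] ᵥ* redTwo γ)).const_mul c)).const_mul
            (sl2Sign (redTwo γ) : ℂ)
        -- `g` has a nonzero limit at every cusp exactly because `c ≠ 0, 1`, so `1 / g` stays
        -- bounded there.
        have hne := mul_ne_zero (sl2Sign_cast_ne_zero (redTwo γ))
          (thetaFormValue_add_mul_ne_zero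
            (vecMul_redTwo_ne_zero γ (show (![0, 1] : Fin 2 → ZMod 2) ≠ 0 by decide))
            (vecMul_redTwo_ne_zero γ (show (![1, 1] : Fin 2 → ZMod 2) ≠ 0 by decide))
            ((vecMul_redTwo_injective γ).ne (by decide)) h0 h1)
        exact ((tendsto_const_nhds (x := (1 : ℂ))).div hlim hne).isBigO_one ℝ }
  have := congrFun (hform.eq_zero_of_neg (by norm_num)) UpperHalfPlane.I
  exact one_div_ne_zero (hgz _) this

/-- A form for `Γ(2)` that vanishes at infinity is divisible by `Θ₂⁴`. -/
lemma IsGammaTwoForm.div_H₂ {k : ℤ} {f : ℍ → ℂ} (hf : IsGammaTwoForm k f)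
    (h0 : IsZeroAtImInfty f) : IsGammaTwoForm (k - 2) (f / H₂) := by
  have hslash (γ) (hγ : γ ∈ Γ(2)) : (f / H₂) ∣[k - 2] γ = f / H₂ := by
    rw [div_slash_SL2, hf.slash_eq γ hγ, isGammaTwoForm_H₂.slash_eq γ hγ]
  have hinf : IsBoundedAtImInfty (f / H₂) := by
    exact (Asymptotics.div_isBoundedUnder_of_isBigO
      ((hf.isBigO_exp h0).trans exp_isBigO_H₂)).isBigO_one ℝ
  have hinfT : IsBoundedAtImInfty ((f / H₂) ∣[k - 2] T) :=
    (hinf.comp_tendsto tendsto_T_smul_atImInfty).congr_left fun z ↦ (slash_T_apply _ _ z).symm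
  refine ⟨hslash, hf.holo.div mdifferentiable_H₂ H₂_ne_zero, fun γ ↦ ?_⟩
  -- If `γ` fixes `(0,1)` modulo `2`, it lies in `Γ(2)` or `Γ(2)T`, and the decay of `f` gives the
  -- bound. Otherwise `Θ₂⁴` has a nonzero limit along `γ`.
  rcases eq_or_ne (![0, 1] ᵥ* redTwo γ) ![0, 1] with hv | hv
  · have key : ∀ A : Matrix (Fin 2) (Fin 2) (ZMod 2), A.det = 1 → ![0, 1] ᵥ* A = ![0, 1] →
        A = 1 ∨ A * redTwo T⁻¹ = 1 := by decide
    rcases key _ (det_redTwo γ) hv with h | h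
    · rwa [hslash γ (CongruenceSubgroup.Gamma_mem'.mpr (Subtype.ext h))]
    · rw [← redTwo_mul] at h
      rw [← inv_mul_cancel_right γ T, SlashAction.slash_mul,
        hslash (γ * T⁻¹) (CongruenceSubgroup.Gamma_mem'.mpr (Subtype.ext h))]
      exact hinfT
  · have hval : ∀ v : Fin 2 → ZMod 2, v ≠ 0 → v ≠ ![0, 1] → thetaFormValue v ≠ 0 := by decide
    have hne : (thetaFormValue (![0, 1] ᵥ* redTwo γ) : ℂ) ≠ 0 := Int.cast_ne_zero.mpr
      (hval _ (vecMul_redTwo_ne_zero γ (by decide)) hv)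
    have hlim := ((tendsto_thetaForm (![0, 1] ᵥ* redTwo γ)).const_mul
      (sl2Sign (redTwo γ) : ℂ)).inv₀ (mul_ne_zero (sl2Sign_cast_ne_zero _) hne)
    rw [div_slash_SL2, ← thetaForm_zero_one, thetaForm_slash, div_eq_mul_inv]
    exact Filter.BoundedAtFilter.mul (hf.bdd γ) (hlim.isBigO_one ℝ)

open Polynomial in
/-- Every form of weight `2k` for `Γ(2)` is `Θ₃^{4k}` times a polynomial in `λ`. -/
theorem IsGammaTwoForm.exists_polynomial {k : ℕ} {f : ℍ → ℂ} (hf : IsGammaTwoForm (2 * k) f) :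
    ∃ P : ℂ[X], ∀ z, f z = H₃ z ^ k * P.eval (lambdaFn z) := by
  induction k generalizing f with
  | zero =>
    obtain ⟨c, rfl⟩ := IsGammaTwoForm.eq_const (by simpa using hf)
    exact ⟨C c, by simp⟩
  | succ k ih =>
    -- Subtracting `a Θ₃^{4(k+1)}` kills the value at infinity; dividing by `Θ₂⁴ = λ Θ₃⁴` then
    -- lowers the weight by two.
    obtain ⟨a, ha⟩ := hf.exists_tendsto
    have h1 := hf.add ((isGammaTwoForm_H₃_pow (k + 1)).smul (-a))
    have h0 : IsZeroAtImInfty (f + -a • H₃ ^ (k + 1)) := by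
      simpa using! ha.add ((tendsto_H₃.pow (k + 1)).const_mul (-a))
    have h2 := h1.div_H₂ h0
    rw [Nat.cast_succ, mul_add, mul_one, add_sub_cancel_right] at h2
    obtain ⟨P, hP⟩ := ih h2
    refine ⟨C a + X * P, fun z ↦ ?_⟩
    have h3 := hP z
    rw [Pi.div_apply, div_eq_iff (H₂_ne_zero z)] at h3
    have h4 : f z = a * H₃ z ^ (k + 1) + (f + -a • H₃ ^ (k + 1)) z := by simp
    have h5 : lambdaFn z * H₃ z = H₂ z := div_mul_cancel₀ _ (H₃_ne_zero z)
    rw [h4, h3, ← h5, eval_add, eval_C, eval_mul, eval_X]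
    ring

end GammaTwoForms

/-! ### Recovering a square summable family from its power sums. -/

section PowerSums

open Filter Topology Polynomial

lemma tsum_ite_const_ne_zero {ι : Type*} {p : ι → Prop} [DecidablePred p] (hfin : {i | p i}.Finite)
    {i : ι} (hi : p i) {c : ℂ} (hc : c ≠ 0) : ∑' j, (if p j then c else 0) ≠ 0 := by
  rw [tsum_eq_sum (s := hfin.toFinset) fun j hj ↦ if_neg (by simpa using hj),
    Finset.sum_congr rfl (g := fun _ ↦ c) fun j hj ↦ if_pos (by simpa using hj), Finset.sum_const,
    nsmul_eq_mul]
  refine mul_ne_zero (Nat.cast_ne_zero.mpr (Finset.card_ne_zero_of_mem (a := i) ?_)) hc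
  simpa using hi

variable {ι : Type*} {x y : ι → ℂ}

lemma finite_norm_le_of_summable_sq (hx : Summable fun i ↦ ‖x i‖ ^ 2) {r : ℝ} (hr : 0 < r) :
    {i | r ≤ ‖x i‖}.Finite := by
  have h := hx.tendsto_cofinite_zero.eventually_lt_const (pow_pos hr 2)
  refine (eventually_cofinite.mp h).subset fun i hi ↦ ?_
  simpa using pow_le_pow_left₀ hr.le (show r ≤ ‖x i‖ from hi) 2

lemma summable_pow_of_summable_sq (hx : Summable fun i ↦ ‖x i‖ ^ 2) {k : ℕ} (hk : 2 ≤ k) :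
    Summable fun i ↦ x i ^ k := by
  refine hx.of_norm_bounded_eventually ?_
  refine (finite_norm_le_of_summable_sq hx one_pos).subset fun i hi ↦ ?_
  by_contra h
  refine hi ?_
  rw [Set.mem_ofPred_eq, norm_pow]
  exact pow_le_pow_of_le_one (norm_nonneg _) (not_le.mp h).le hk

/-- Values smaller than `a` in modulus die in the limit and `p` kills the other values except `a`,
so the limit counts the occurrences of `a`. -/
lemma tendsto_tsum_pow_mul_eval (hx : Summable fun i ↦ ‖x i‖ ^ 2) {a : ℂ} (ha : a ≠ 0) {p : ℂ[X]}
    (hp : ∀ i, x i ≠ a → ‖a‖ ≤ ‖x i‖ → p.eval (x i) = 0) :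
    Tendsto (fun m : ℕ ↦ ∑' i, (x i / a) ^ (m + 2) * p.eval (x i)) atTop
      (𝓝 (∑' i, if x i = a then p.eval a else 0)) := by
  have ha' : 0 < ‖a‖ := norm_pos_iff.mpr ha
  obtain ⟨C, hC⟩ := (isCompact_closedBall (0 : ℂ) ‖a‖).exists_bound_of_continuousOn
    p.continuous.continuousOn
  refine tendsto_tsum_of_dominated_convergence (bound := fun i ↦ C / ‖a‖ ^ 2 * ‖x i‖ ^ 2)
    (hx.mul_left _) (fun i ↦ ?_) (.of_forall fun m i ↦ ?_)
  · split_ifs with h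
    · simp [h, ha]
    · rcases le_or_gt ‖a‖ ‖x i‖ with h1 | h1
      · simp [hp i h h1]
      · have h2 : ‖x i / a‖ < 1 := by rwa [norm_div, div_lt_one ha']
        simpa using ((tendsto_add_atTop_iff_nat 2).mpr
          (tendsto_pow_atTop_nhds_zero_of_norm_lt_one h2)).mul_const (p.eval (x i))
  · by_cases h : ‖x i‖ ≤ ‖a‖
    · have h1 := hC (x i) (mem_closedBall_zero_iff.mpr h)
      have h2 : ‖x i / a‖ ≤ 1 := by rwa [norm_div, div_le_one ha']
      calc ‖(x i / a) ^ (m + 2) * p.eval (x i)‖ = ‖x i / a‖ ^ (m + 2) * ‖p.eval (x i)‖ := by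
            rw [norm_mul, norm_pow]
        _ ≤ ‖x i / a‖ ^ 2 * C := mul_le_mul (pow_le_pow_of_le_one (norm_nonneg _) h2 (by omega)) h1
            (norm_nonneg _) (by positivity)
        _ = C / ‖a‖ ^ 2 * ‖x i‖ ^ 2 := by rw [norm_div, div_pow]; ring
    · have h1 := hp i (fun h2 ↦ h (h2 ▸ le_rfl)) (not_le.mp h).le
      have hC0 := (norm_nonneg _).trans (hC 0 (by simp))
      rw [h1, mul_zero, norm_zero]
      positivity

lemma tsum_pow_mul_eval (hx : Summable fun i ↦ ‖x i‖ ^ 2) (a : ℂ) (p : ℂ[X]) (m : ℕ) :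
    ∑' i, (x i / a) ^ (m + 2) * p.eval (x i) =
      ∑ n ∈ p.support, p.coeff n / a ^ (m + 2) * ∑' i, x i ^ (m + 2 + n) := by
  simp_rw [← tsum_mul_left]
  rw [← Summable.tsum_finsetSum fun n _ ↦
    (summable_pow_of_summable_sq hx (by omega)).mul_left _]
  refine tsum_congr fun i ↦ ?_
  rw [eval_eq_sum, Polynomial.sum, Finset.mul_sum]
  refine Finset.sum_congr rfl fun n _ ↦ ?_
  rw [div_pow]
  ring

/-- The power sums of exponent at least two determine the nonzero values of a square summable
family. -/
theorem exists_eq_of_tsum_pow_eq (hx : Summable fun i ↦ ‖x i‖ ^ 2) (hy : Summable fun i ↦ ‖y i‖ ^ 2)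
    (h : ∀ k, 2 ≤ k → ∑' i, x i ^ k = ∑' i, y i ^ k) (i : ι) (hi : x i ≠ 0) :
    ∃ j, y j = x i := by
  classical
  by_contra! hne
  set a := x i with ha
  have hfx := finite_norm_le_of_summable_sq hx (norm_pos_iff.mpr hi)
  have hfy := finite_norm_le_of_summable_sq hy (norm_pos_iff.mpr hi)
  -- The finitely many values of modulus at least `‖a‖`, other than `a`. With `p` vanishing on them,
  -- the limit is a positive multiple of `p(a)` for `x` but `0` for `y`, while equal power sums
  -- force equal limits.
  set F : Finset ℂ := (hfx.toFinset.image x ∪ hfy.toFinset.image y).erase a with hF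
  set p : ℂ[X] := ∏ z ∈ F, (X - C z) with hp
  have hp0 {z : ℂ} (hz : z ∈ F) : p.eval z = 0 := by
    rw [hp, eval_prod]
    exact Finset.prod_eq_zero hz (by simp)
  have hpa : p.eval a ≠ 0 := by
    rw [hp, eval_prod]
    refine Finset.prod_ne_zero_iff.mpr fun z hz ↦ ?_
    rw [eval_sub, eval_X, eval_C, sub_ne_zero]
    exact (Finset.ne_of_mem_erase hz).symm
  have h1 := tendsto_tsum_pow_mul_eval hx hi (p := p) fun j hj hj' ↦ hp0 <|
    Finset.mem_erase.mpr ⟨hj, Finset.mem_union_left _ (Finset.mem_image_of_mem _ (by simpa))⟩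
  have h2 := tendsto_tsum_pow_mul_eval hy hi (p := p) fun j hj hj' ↦ hp0 <|
    Finset.mem_erase.mpr ⟨hj, Finset.mem_union_right _ (Finset.mem_image_of_mem _ (by simpa))⟩
  have h3 (m : ℕ) : ∑' i, (x i / a) ^ (m + 2) * p.eval (x i) =
      ∑' i, (y i / a) ^ (m + 2) * p.eval (y i) := by
    rw [tsum_pow_mul_eval hx, tsum_pow_mul_eval hy]
    exact Finset.sum_congr rfl fun n _ ↦ by rw [h _ (by omega)]
  have h4 := tendsto_nhds_unique (h1.congr h3) h2
  simp only [hne, if_false, tsum_zero] at h4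
  exact tsum_ite_const_ne_zero (hfx.subset fun j (hj : x j = a) ↦ (congrArg norm hj).ge) ha.symm
    hpa h4

end PowerSums

/-! ### Injectivity of `λ` on `Γ(2)`-orbits via Eisenstein series. -/

section Injectivity

open UpperHalfPlane hiding I
open Complex ModularForm EisensteinSeries Matrix
open scoped MatrixGroups CongruenceSubgroup

lemma isGammaTwoForm_eisensteinSeries {k : ℕ} (hk : 2 ≤ k) (a : Fin 2 → ZMod 2) :
    IsGammaTwoForm (2 * k) (eisensteinSeries a (2 * k)) := by
  have hk' : 3 ≤ (2 * k : ℤ) := by omega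
  refine ⟨fun γ hγ ↦ ?_, eisensteinSeriesSIF_mdifferentiable hk' a,
    isBoundedAtImInfty_eisensteinSeriesSIF a hk'⟩
  rw [eisensteinSeries_slash_apply, CongruenceSubgroup.Gamma_mem'.mp hγ]
  simp

/-- Turns the Eisenstein series of all even weights into power sums of one family. -/
lemma eisSummand_two_mul (k : ℕ) (v : Fin 2 → ℤ) (z : ℍ) :
    eisSummand (2 * k) v z = eisSummand 2 v z ^ k := by
  rw [eisSummand, eisSummand, ← zpow_natCast, ← _root_.zpow_mul, neg_mul]

lemma summable_norm_eisSummand_two_sq (a : Fin 2 → ZMod 2) (z : ℍ) :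
    Summable fun v : gammaSet 2 1 a ↦ ‖eisSummand 2 v z‖ ^ 2 := by
  refine ((summable_norm_eisSummand (k := 4) (by norm_num) z).subtype _).congr fun v ↦ ?_
  rw [← norm_pow, ← eisSummand_two_mul]
  rfl

lemma linear_ne_zero_of_mem_gammaSet {a : Fin 2 → ZMod 2} {v : Fin 2 → ℤ} (hv : v ∈ gammaSet 2 1 a)
    (z : ℍ) : (v 0 * z + v 1 : ℂ) ≠ 0 := by
  have hne : v ≠ 0 := by
    rintro rfl
    simpa using hv.2
  have := linear_ne_zero (cd := fun i ↦ (v i : ℝ)) z fun h ↦ hne <| funext fun i ↦ by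
    simpa using congrFun h i
  simpa using this

lemma exists_mem_gammaSet_of_lambdaFn_eq {z w : ℍ} (h : lambdaFn z = lambdaFn w)
    {a : Fin 2 → ZMod 2} {v : Fin 2 → ℤ} (hv : v ∈ gammaSet 2 1 a) :
    ∃ u ∈ gammaSet 2 1 a,
      (u 0 * w + u 1 : ℂ) ^ 2 = H₃ z / H₃ w * (v 0 * z + v 1) ^ 2 := by
  have hμ : H₃ z / H₃ w ≠ 0 := div_ne_zero (H₃_ne_zero z) (H₃_ne_zero w)
  have hsum (k : ℕ) (hk : 2 ≤ k) : ∑' v : gammaSet 2 1 a, eisSummand 2 v z ^ k =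
      ∑' v : gammaSet 2 1 a, (H₃ z / H₃ w * eisSummand 2 v w) ^ k := by
    obtain ⟨P, hP⟩ := (isGammaTwoForm_eisensteinSeries hk a).exists_polynomial
    have h1 := hP z
    have h2 := hP w
    simp only [eisensteinSeries, eisSummand_two_mul] at h1 h2
    simp_rw [mul_pow, tsum_mul_left, h1, h2, h, div_pow]
    have := H₃_ne_zero w
    field_simp
  have hne := linear_ne_zero_of_mem_gammaSet hv z
  obtain ⟨⟨u, hu⟩, huv⟩ := exists_eq_of_tsum_pow_eq (summable_norm_eisSummand_two_sq a z)
    (y := fun v : gammaSet 2 1 a ↦ H₃ z / H₃ w * eisSummand 2 v w)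
    (by simp_rw [norm_mul, mul_pow]; exact (summable_norm_eisSummand_two_sq a w).mul_left _)
    hsum ⟨v, hv⟩ (zpow_ne_zero _ hne)
  refine ⟨u, hu, ?_⟩
  have hu0 := linear_ne_zero_of_mem_gammaSet hu w
  have hpow (t : ℂ) : t ^ (-2 : ℤ) = (t ^ 2)⁻¹ := by rw [_root_.zpow_neg]; norm_cast
  simp only [eisSummand, hpow] at huv
  field_simp at huv ⊢
  linear_combination -huv

/-- Matching `(0,1)` and `(1,0)` at `z` with `u` and `t` at `w`, the squares of `z(u₀w + u₁)` and
`t₀w + t₁` agree. The sign left open is harmless modulo `2`. The last identity controls the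
determinant. -/
lemma exists_matrix_of_lambdaFn_eq {z w : ℍ} (h : lambdaFn z = lambdaFn w) :
    ∃ a b c d : ℤ, ((a : ZMod 2) = 1 ∧ (b : ZMod 2) = 0 ∧ (c : ZMod 2) = 0 ∧ (d : ZMod 2) = 1) ∧
      (z : ℂ) * (c * w + d) = a * w + b ∧
      z.im * ‖H₃ z / H₃ w‖ = (a * d - b * c) * w.im := by
  obtain ⟨u, hu, hu'⟩ := exists_mem_gammaSet_of_lambdaFn_eq h (a := ![0, 1]) (v := ![0, 1])
    ⟨by ext i; fin_cases i <;> simp, by simp⟩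
  obtain ⟨t, ht, ht'⟩ := exists_mem_gammaSet_of_lambdaFn_eq h (a := ![1, 0]) (v := ![1, 0])
    ⟨by ext i; fin_cases i <;> simp, by simp⟩
  have hu0 := congrFun hu.1 0
  have hu1 := congrFun hu.1 1
  have ht0 := congrFun ht.1 0
  have ht1 := congrFun ht.1 1
  simp at hu' ht' hu0 hu1 ht0 ht1
  have him (a b : ℤ) (hz : (z : ℂ) * (u 0 * w + u 1) = a * w + b) :
      z.im * ‖H₃ z / H₃ w‖ = (a * u 1 - b * u 0) * w.im := by
    rw [← hu', norm_pow, ← Complex.normSq_eq_norm_sq, normSq_apply]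
    have h1 := congrArg Complex.re hz
    have h2 := congrArg Complex.im hz
    simp at h1 h2 ⊢
    linear_combination (u 0 * w.re + u 1 : ℝ) * h2 - (u 0 * w.im : ℝ) * h1
  have hsq : ((z : ℂ) * (u 0 * w + u 1)) ^ 2 = (t 0 * w + t 1) ^ 2 := by
    rw [mul_pow, hu', ht']; ring
  rcases sq_eq_sq_iff_eq_or_eq_neg.mp hsq with hz | hz
  · exact ⟨t 0, t 1, u 0, u 1, ⟨ht0, ht1, hu0, hu1⟩, hz, him _ _ hz⟩
  · have hz' : (z : ℂ) * (u 0 * w + u 1) = (-t 0 : ℤ) * w + (-t 1 : ℤ) := by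
      rw [hz]; push_cast; ring
    refine ⟨-t 0, -t 1, u 0, u 1, ⟨?_, ?_, hu0, hu1⟩, hz', him _ _ hz'⟩
    · push_cast; rw [ht0]; decide
    · push_cast; rw [ht1]; decide

/-- Points with the same value of `λ` are equivalent under `Γ(2)`. -/
theorem exists_smul_eq_of_lambdaFn_eq {z w : ℍ} (h : lambdaFn z = lambdaFn w) :
    ∃ γ ∈ Γ(2), γ • w = z := by
  obtain ⟨a, b, c, d, ⟨ha, hb, hc, hd⟩, hz, him⟩ := exists_matrix_of_lambdaFn_eq h
  -- Exchanging `z` and `w` inverts the scalar, so the two integer determinants have product `1`;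
  -- positivity of the first makes it `1`.
  obtain ⟨a', b', c', d', -, -, him'⟩ := exists_matrix_of_lambdaFn_eq h.symm
  have hzi := z.im_pos
  have hwi := w.im_pos
  have hμ : 0 < ‖H₃ z / H₃ w‖ := norm_pos_iff.mpr (div_ne_zero (H₃_ne_zero z) (H₃_ne_zero w))
  rw [← inv_div, norm_inv] at him'
  have hD : (0 : ℝ) < (a * d - b * c : ℤ) := by
    push_cast
    exact pos_of_mul_pos_left (him ▸ mul_pos hzi hμ) hwi.le
  have hprod : ((a * d - b * c : ℤ) : ℝ) * (a' * d' - b' * c' : ℤ) = 1 := by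
    push_cast
    have h1 : (a * d - b * c) * w.im * ((a' * d' - b' * c') * z.im) = z.im * w.im := by
      rw [← him, ← him']; field_simp
    refine mul_right_cancel₀ (mul_pos hzi hwi).ne' ?_
    linear_combination h1
  have hdet : a * d - b * c = 1 :=
    Int.eq_one_of_mul_eq_one_right (Int.cast_pos.mp hD).le (mod_cast hprod)
  let γ : SL(2, ℤ) := ⟨!![a, b; c, d], by rw [det_fin_two_of, hdet]⟩
  refine ⟨γ, CongruenceSubgroup.Gamma_mem.mpr ⟨ha, hb, hc, hd⟩, ?_⟩
  have hne : (c * w + d : ℂ) ≠ 0 := by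
    have := denom_ne_zero γ w
    rw [ModularGroup.denom_apply] at this
    simpa [γ] using this
  ext
  rw [coe_specialLinearGroup_apply]
  simp only [γ, algebraMap_int_eq, eq_intCast, of_apply, cons_val', cons_val_zero, cons_val_one,
    cons_val_fin_one, ofReal_intCast]
  rw [div_eq_iff hne, hz]

lemma lambdaFn_smul {γ : SL(2, ℤ)} (hγ : γ ∈ Γ(2)) (z : ℍ) : lambdaFn (γ • z) = lambdaFn z := by
  have h := congrFun (div_slash_SL2 2 2 γ H₂ H₃) z
  rw [isGammaTwoForm_H₂.slash_eq γ hγ, isGammaTwoForm_H₃.slash_eq γ hγ, SL_slash_apply] at h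
  simpa using! h

lemma lambdaFn_comp_rep_injective {rep : Y2 → ℍ} (hrep : IsRepSystem rep) :
    Function.Injective fun y ↦ lambdaFn (rep y) := fun x y h ↦ by
  obtain ⟨γ, hγ, hz⟩ := exists_smul_eq_of_lambdaFn_eq h
  rw [← hrep x, ← hrep y]
  exact Quotient.sound' ⟨⟨γ, hγ⟩, hz⟩

lemma range_lambdaFn_comp_rep {rep : Y2 → ℍ} (hrep : IsRepSystem rep) :
    Set.range (fun y ↦ lambdaFn (rep y)) = {0, 1}ᶜ := by
  refine Set.Subset.antisymm ?_ fun c hc ↦ ?_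
  · rintro _ ⟨y, rfl⟩
    simp [lambdaFn_ne_zero, lambdaFn_ne_one]
  · simp only [Set.mem_compl_iff, Set.mem_insert_iff, Set.mem_singleton_iff, not_or] at hc
    obtain ⟨z, rfl⟩ := exists_lambdaFn_eq hc.1 hc.2
    obtain ⟨⟨γ, hγ⟩, hz⟩ := Quotient.exact' (hrep (Quotient.mk'' z))
    exact ⟨Quotient.mk'' z, by rw [← lambdaFn_smul hγ z]; exact congrArg lambdaFn hz.symm⟩

end Injectivity

/-! ### Orders of vanishing as root multiplicities. -/

section VanishingOrder

open UpperHalfPlane hiding I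
open Complex Polynomial
open scoped Manifold

lemma analyticAt_comp_ofComplex {f : ℍ → ℂ} (hf : MDiff f) (τ : ℍ) :
    AnalyticAt ℂ (f ∘ ofComplex) τ :=
  (UpperHalfPlane.mdifferentiable_iff.mp hf).analyticAt
    (isOpen_upperHalfPlaneSet.mem_nhds τ.im_pos)

lemma analyticOrderAt_polynomial_eval {P : ℂ[X]} (hP : P ≠ 0) (c : ℂ) :
    analyticOrderAt (fun x ↦ P.eval x) c = P.rootMultiplicity c := by
  obtain ⟨Q, hQ, hdvd⟩ := exists_eq_pow_rootMultiplicity_mul_and_not_dvd P hP c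
  rw [AnalyticAt.analyticOrderAt_eq_natCast (AnalyticOnNhd.eval_polynomial P c trivial)]
  refine ⟨fun x ↦ Q.eval x, AnalyticOnNhd.eval_polynomial Q c trivial,
    fun h ↦ hdvd (dvd_iff_isRoot.mpr h), .of_forall fun x ↦ ?_⟩
  conv_lhs => rw [hQ]
  simp

/-- `Θ₃` has no zeros and `λ` is a local coordinate, as its derivative does not vanish. -/
lemma analyticOrderAt_eq_rootMultiplicity {f : ℍ → ℂ} {n : ℕ} {P : ℂ[X]}
    (hf : ∀ z, f z = H₃ z ^ n * P.eval (lambdaFn z)) (hP : P ≠ 0) (τ : ℍ) :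
    AnalyticAt ℂ (f ∘ ofComplex) τ ∧
      analyticOrderAt (f ∘ ofComplex) τ = P.rootMultiplicity (lambdaFn τ) := by
  have h3 := (analyticAt_comp_ofComplex mdifferentiable_H₃ τ).pow n
  have hl := analyticAt_comp_ofComplex mdifferentiable_lambdaFn τ
  have hp : AnalyticAt ℂ (fun x ↦ P.eval x) ((lambdaFn ∘ ofComplex) τ) :=
    AnalyticOnNhd.eval_polynomial P _ trivial
  have hfe : f ∘ ofComplex =
      (H₃ ∘ ofComplex) ^ n * ((fun x ↦ P.eval x) ∘ (lambdaFn ∘ ofComplex)) :=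
    funext fun z ↦ hf _
  rw [hfe]
  refine ⟨h3.mul (hp.comp hl), ?_⟩
  rw [analyticOrderAt_mul h3 (hp.comp hl),
    analyticOrderAt_comp_of_deriv_ne_zero hl (deriv_lambdaFn_ne_zero τ),
    analyticOrderAt_polynomial_eval hP, h3.analyticOrderAt_eq_zero.mpr, zero_add,
    Function.comp_apply, ofComplex_apply]
  exact pow_ne_zero n (H₃_ne_zero _)

lemma holNonzeroAt_of_polynomial {f : ℍ → ℂ} {n : ℕ} {P : ℂ[X]}
    (hf : ∀ z, f z = H₃ z ^ n * P.eval (lambdaFn z)) (hP : P ≠ 0) (τ : ℍ) : HolNonzeroAt f τ := by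
  obtain ⟨h1, h2⟩ := analyticOrderAt_eq_rootMultiplicity hf hP τ
  exact ⟨h1, by rw [h2]; exact ENat.natCast_ne_top _⟩

lemma ordAt_eq_rootMultiplicity {f : ℍ → ℂ} {n : ℕ} {P : ℂ[X]}
    (hf : ∀ z, f z = H₃ z ^ n * P.eval (lambdaFn z)) (hP : P ≠ 0) (τ : ℍ) :
    ordAt f τ = P.rootMultiplicity (lambdaFn τ) := by
  rw [ordAt, analyticOrderNatAt, (analyticOrderAt_eq_rootMultiplicity hf hP τ).2, ENat.toNat_natCast]

variable {R : ℂ[X]} {rep : Y2 → ℍ}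

lemma finite_rootMultiplicity_ne_zero (hrep : IsRepSystem rep) (hR : R ≠ 0) :
    {y : Y2 | R.rootMultiplicity (lambdaFn (rep y)) ≠ 0}.Finite := by
  refine (R.roots.toFinset.finite_toSet.preimage
    (lambdaFn_comp_rep_injective hrep).injOn).subset fun y hy ↦ ?_
  rw [Set.mem_preimage, Finset.mem_coe, Multiset.mem_toFinset, mem_roots hR]
  exact (rootMultiplicity_pos hR).mp (Nat.pos_of_ne_zero hy)

/-- All roots of `R` lie in `ℂ ∖ {0, 1}`, the bijective image of the orbits under `λ`. The sum is
therefore over all roots and is read off from the partial fractions of `R'/R` at `0`. -/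
lemma finsum_rootMultiplicity_div (hrep : IsRepSystem rep) (h0 : R.eval 0 ≠ 0)
    (h1 : R.eval 1 ≠ 0) :
    ∑ᶠ y : Y2, (R.rootMultiplicity (lambdaFn (rep y)) : ℂ) * (1 / lambdaFn (rep y)) =
      -(R.derivative.eval 0 / R.eval 0) := by
  have hR : R ≠ 0 := by rintro rfl; simp at h0
  set g : ℂ → ℂ := fun c ↦ (R.rootMultiplicity c : ℂ) * (1 / c) with hg
  have hsupp (c : ℂ) (hc : c ∈ Function.support g) : c ∈ R.roots.toFinset := by
    rw [Multiset.mem_toFinset, mem_roots hR]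
    refine (rootMultiplicity_pos hR).mp (Nat.pos_of_ne_zero fun h ↦ hc ?_)
    simp [hg, h]
  have hmem (c : ℂ) (hc : c ∈ Function.support g) :
      c ∈ Set.range (fun y ↦ lambdaFn (rep y)) ↔ c ∈ Set.univ := by
    have := isRoot_of_mem_roots (Multiset.mem_toFinset.mp (hsupp c hc))
    rw [range_lambdaFn_comp_rep hrep]
    refine iff_of_true ?_ trivial
    rintro (rfl | rfl)
    exacts [h0 this, h1 this]
  rw [← finsum_mem_range (f := g) (lambdaFn_comp_rep_injective hrep),
    finsum_mem_inter_support_eq' g _ _ hmem, finsum_mem_univ,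
    finsum_eq_sum_of_support_subset g (s := R.roots.toFinset) fun c hc ↦ hsupp c hc,
    (IsAlgClosed.splits R).eval_derivative_div_eval_of_ne_zero h0, Finset.sum_multiset_map_count,
    ← Finset.sum_neg_distrib]
  refine Finset.sum_congr rfl fun c _ ↦ ?_
  rw [hg, count_roots, nsmul_eq_mul, zero_sub, one_div_neg_eq_neg_one_div, mul_neg, neg_neg]

end VanishingOrder

/-! ### The polynomials of the Eisenstein series: values at `0`, `1` and the derivative at `0`. -/

section EisensteinPolynomials

open UpperHalfPlane hiding I
open Complex Polynomial Filter Topology ModularGroup EisensteinSeries ModularForm Matrix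

/-- A sequence of points tending to infinity along the imaginary axis. -/
noncomputable def imagPt (n : ℕ) : ℍ := ⟨(n + 1 : ℝ) * I, by simp; positivity⟩

lemma coe_imagPt (n : ℕ) : (imagPt n : ℂ) = (n + 1 : ℝ) * I := rfl

lemma tendsto_imagPt : Tendsto imagPt atTop atImInfty := by
  refine tendsto_comap_iff.mpr ?_
  have : UpperHalfPlane.im ∘ imagPt = fun n : ℕ ↦ (n : ℝ) + 1 := by
    ext n
    rw [Function.comp_apply, ← coe_im, coe_imagPt]
    simp
  rw [this]
  exact tendsto_atTop_add_const_right _ _ tendsto_natCast_atTop_atTop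

lemma normSq_linear_imagPt (v : Fin 2 → ℤ) (n : ℕ) :
    ‖(v 0 * imagPt n + v 1 : ℂ)‖ ^ 2 = (v 0 : ℝ) ^ 2 * (n + 1) ^ 2 + (v 1 : ℝ) ^ 2 := by
  rw [← normSq_eq_norm_sq, normSq_apply, coe_imagPt]
  simp
  ring

lemma norm_eisSummand_imagPt (k : ℕ) (v : Fin 2 → ℤ) (n : ℕ) :
    ‖eisSummand (2 * k) v (imagPt n)‖ =
      (((v 0 : ℝ) ^ 2 * (n + 1) ^ 2 + (v 1 : ℝ) ^ 2) ^ k)⁻¹ := by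
  rw [eisSummand, norm_zpow, ← normSq_linear_imagPt, ← pow_mul, _root_.zpow_neg]
  norm_cast

/-- On the imaginary axis `|c·it + d|² = c²t² + d²` does not decrease in `t`, so the summands at
`i`, which is `imagPt 0`, dominate. Those with `c ≠ 0` tend to `0`; for `c = 0` coprimality forces
`d = ±1`. -/
lemma tendsto_eisensteinSeries_imagPt {k : ℕ} (hk : 2 ≤ k) (a : Fin 2 → ZMod 2) :
    Tendsto (fun n ↦ eisensteinSeries a (2 * k) (imagPt n)) atTop
      (𝓝 (∑' v : gammaSet 2 1 a, if v.1 0 = 0 then 1 else 0)) := by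
  refine tendsto_tsum_of_dominated_convergence
    (bound := fun v : gammaSet 2 1 a ↦ ‖eisSummand (2 * k) v (imagPt 0)‖)
    ((summable_norm_eisSummand (by omega) _).subtype _) (fun v ↦ ?_) (.of_forall fun n v ↦ ?_)
  · split_ifs with h
    · have h1 : (v.1 1 : ℂ) ^ 2 = 1 := by
        have := v.2.2
        rw [h, Int.gcd_zero_left] at this
        rcases Int.natAbs_eq_iff.mp this with h | h <;> simp [h]
      have h2 (n : ℕ) : eisSummand (2 * k) v (imagPt n) = 1 := by
        rw [eisSummand, h, Int.cast_zero, zero_mul, zero_add, _root_.zpow_neg, _root_.zpow_mul,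
          zpow_ofNat, h1, _root_.one_zpow, inv_one]
      simp [h2]
    · refine tendsto_zero_iff_norm_tendsto_zero.mpr ?_
      simp_rw [norm_eisSummand_imagPt]
      refine tendsto_inv_atTop_zero.comp ?_
      refine tendsto_atTop_mono (fun n ↦ ?_) (tendsto_natCast_atTop_atTop (R := ℝ))
      have h1 : (1 : ℝ) ≤ (v.1 0 : ℝ) ^ 2 := by
        exact_mod_cast (one_le_sq_iff_one_le_abs _).mpr (Int.one_le_abs h)
      have h2 : (n : ℝ) + 1 ≤ (v.1 0 : ℝ) ^ 2 * (n + 1) ^ 2 + (v.1 1 : ℝ) ^ 2 := by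
        nlinarith [sq_nonneg (v.1 1 : ℝ), sq_nonneg ((n : ℝ) + 1), (n.cast_nonneg : (0 : ℝ) ≤ n)]
      calc (n : ℝ) ≤ n + 1 := by linarith
        _ ≤ _ := h2
        _ ≤ _ := le_self_pow₀ (by linarith [(n.cast_nonneg : (0 : ℝ) ≤ n)]) (by omega)
  · rw [norm_eisSummand_imagPt, norm_eisSummand_imagPt]
    have hpos : (0 : ℝ) < (v.1 0 : ℝ) ^ 2 * ((0 : ℕ) + 1) ^ 2 + (v.1 1 : ℝ) ^ 2 := by
      rw [← normSq_linear_imagPt]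
      exact pow_pos (norm_pos_iff.mpr (linear_ne_zero_of_mem_gammaSet v.2 _)) 2
    refine inv_anti₀ (pow_pos hpos k) (pow_le_pow_left₀ hpos.le ?_ k)
    have : ((0 : ℕ) + 1 : ℝ) ≤ n + 1 := by simp
    gcongr

lemma tsum_gammaSet_zero_one_ne_zero :
    ∑' v : gammaSet 2 1 ![0, 1], (if v.1 0 = 0 then 1 else 0 : ℂ) ≠ 0 := by
  refine tsum_ite_const_ne_zero (i := ⟨![0, 1], by ext i; fin_cases i <;> simp, by simp⟩) ?_
    (by simp) one_ne_zero
  refine Set.Finite.of_finite_image (f := fun v : gammaSet 2 1 ![0, 1] ↦ v.1 1)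
    (Set.Finite.subset (Set.toFinite {1, -1}) ?_) fun v hv w hw h ↦ ?_
  · rintro _ ⟨v, hv, rfl⟩
    have := v.2.2
    rw [show v.1 0 = 0 from hv, Int.gcd_zero_left] at this
    simpa using Int.natAbs_eq_iff.mp this
  · ext i
    fin_cases i
    · exact (show v.1 0 = 0 from hv).trans (show w.1 0 = 0 from hw).symm
    · exact h

lemma tsum_gammaSet_one_zero :
    ∑' v : gammaSet 2 1 ![1, 0], (if v.1 0 = 0 then 1 else 0 : ℂ) = 0 := by
  refine (tsum_congr fun v ↦ if_neg fun h ↦ ?_).trans tsum_zero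
  have := congrFun v.2.1 0
  simp [h] at this

lemma eval_zero_of_tendsto {f : ℍ → ℂ} {n : ℕ} {P : ℂ[X]} {a : ℂ}
    (hf : ∀ z, f z = H₃ z ^ n * P.eval (lambdaFn z))
    (ha : Tendsto (fun m ↦ f (imagPt m)) atTop (𝓝 a)) : P.eval 0 = a := by
  have h1 := (tendsto_H₃.comp tendsto_imagPt).pow n
  have h2 := (P.continuous.tendsto 0).comp (tendsto_lambdaFn.comp tendsto_imagPt)
  have h3 := (h1.mul h2).congr fun m ↦ (hf _).symm
  rw [one_pow, one_mul] at h3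
  exact tendsto_nhds_unique h3 ha

lemma polynomial_eq_of_eval_eq {P Q : ℂ[X]} (h : ∀ c, c ≠ 0 → c ≠ 1 → P.eval c = Q.eval c) :
    P = Q := by
  refine eq_of_infinite_eval_eq P Q ?_
  refine Set.Infinite.mono (s := {0, 1}ᶜ) (fun c hc ↦ ?_) (Set.toFinite _).infinite_compl
  simp only [Set.mem_compl_iff, Set.mem_insert_iff, Set.mem_singleton_iff, not_or] at hc
  exact h c hc.1 hc.2

variable {k : ℕ} {P Q : ℂ[X]}

lemma polynomial_slash_S {f g : ℍ → ℂ} (hf : ∀ z, f z = H₃ z ^ k * P.eval (lambdaFn z))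
    (hg : ∀ z, g z = H₃ z ^ k * Q.eval (lambdaFn z)) (h : f ∣[(2 * k : ℤ)] S = g) :
    C ((-1) ^ k) * P.comp (1 - X) = Q := by
  refine polynomial_eq_of_eval_eq fun c h0 h1 ↦ ?_
  obtain ⟨z, rfl⟩ := exists_lambdaFn_eq h0 h1
  have h2 := congrFun h z
  have hz := z.ne_zero
  have h3 := pow_ne_zero k (H₃_ne_zero z)
  rw [slash_S_apply, hf, hg, H₃_S_smul, lambdaFn_S_smul, _root_.zpow_neg, _root_.zpow_mul,
    zpow_ofNat, zpow_natCast, mul_pow, neg_pow] at h2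
  have hz' : ((z : ℂ) ^ 2) ^ k ≠ 0 := by positivity
  field_simp at h2
  simpa using h2

/-- `T` sends `Θ₃⁴` to `Θ₄⁴ = (1 - λ) Θ₃⁴` and `λ` to `λ/(λ - 1)`. -/
lemma polynomial_slash_T {f : ℍ → ℂ} (hf : ∀ z, f z = H₃ z ^ k * P.eval (lambdaFn z))
    (h : f ∣[(2 * k : ℤ)] T = f) {c : ℂ} (h0 : c ≠ 0) (h1 : c ≠ 1) :
    (1 - c) ^ k * P.eval (c / (c - 1)) = P.eval c := by
  obtain ⟨z, rfl⟩ := exists_lambdaFn_eq h0 h1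
  have h2 := congrFun h z
  have h3 := pow_ne_zero k (H₃_ne_zero z)
  rw [slash_T_apply, hf, hf, H₃_T_smul, lambdaFn_T_smul] at h2
  rw [one_sub_lambdaFn, div_pow, div_mul_eq_mul_div, h2]
  field_simp

/-- Differentiate at `0`, a fixed point of `c ↦ c/(c - 1)` with derivative `-1` there. The factor
`(1 - c)^k` contributes the `-k`. -/
lemma derivative_eval_zero (h : ∀ c : ℂ, c ≠ 0 → c ≠ 1 →
    (1 - c) ^ k * P.eval (c / (c - 1)) = P.eval c) :
    2 * P.derivative.eval 0 = -k * P.eval 0 := by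
  have hd : HasDerivAt (fun c : ℂ ↦ (1 - c) ^ k * P.eval (c / (c - 1)) - P.eval c)
      (-k * P.eval 0 - P.derivative.eval 0 - P.derivative.eval 0) 0 := by
    have h1 : HasDerivAt (fun c : ℂ ↦ (1 - c) ^ k) (-k) 0 := by
      exact (((hasDerivAt_id' (0 : ℂ)).const_sub 1).fun_pow k).congr_deriv (by simp)
    have h2 : HasDerivAt (fun c : ℂ ↦ c / (c - 1)) (-1) 0 := by
      exact ((hasDerivAt_id' (0 : ℂ)).fun_div ((hasDerivAt_id' (0 : ℂ)).sub_const 1)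
        (by simp)).congr_deriv (by simp)
    have h3 : HasDerivAt (fun c : ℂ ↦ P.eval (c / (c - 1))) (P.derivative.eval 0 * -1) 0 :=
      HasDerivAt.comp 0 (h₂ := fun x ↦ P.eval x) (h := fun c : ℂ ↦ c / (c - 1))
        (by simpa using P.hasDerivAt (0 : ℂ)) h2
    refine ((h1.mul h3).sub (P.hasDerivAt 0)).congr_deriv ?_
    simp
    ring
  have hz : (fun c : ℂ ↦ (1 - c) ^ k * P.eval (c / (c - 1)) - P.eval c) =ᶠ[𝓝 0] fun _ ↦ 0 := by
    filter_upwards [eventually_ne_nhds (zero_ne_one (α := ℂ))] with c hc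
    rcases eq_or_ne c 0 with rfl | h0
    · simp
    · rw [h c h0 hc, sub_self]
  have := hd.unique ((hasDerivAt_const (0 : ℂ) (0 : ℂ)).congr_of_eventuallyEq hz)
  linear_combination -this

/-- The forms `E_{2k}^±` are `Θ₃^{4k}` times polynomials in `λ` which do not vanish at `0` and `1`,
and whose logarithmic derivatives at `0` add up to `-k`. -/
theorem exists_polynomials_EPlus_EMinus (hk : 2 ≤ k) :
    ∃ P Q : ℂ[X], (∀ z, EPlus k z = H₃ z ^ k * P.eval (lambdaFn z)) ∧
      (∀ z, EMinus k z = H₃ z ^ k * Q.eval (lambdaFn z)) ∧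
      P.eval 0 ≠ 0 ∧ Q.eval 0 ≠ 0 ∧ P.eval 1 ≠ 0 ∧ Q.eval 1 ≠ 0 ∧
      P.derivative.eval 0 / P.eval 0 + Q.derivative.eval 0 / Q.eval 0 = -k := by
  obtain ⟨A, hA⟩ := (isGammaTwoForm_eisensteinSeries hk ![0, 1]).exists_polynomial
  obtain ⟨B, hB⟩ := (isGammaTwoForm_eisensteinSeries hk ![1, 0]).exists_polynomial
  have hA0 := eval_zero_of_tendsto hA (tendsto_eisensteinSeries_imagPt hk _)
  have hB0 := eval_zero_of_tendsto hB (tendsto_eisensteinSeries_imagPt hk _)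
  rw [tsum_gammaSet_one_zero] at hB0
  have hL : A.eval 0 ≠ 0 := hA0 ▸ tsum_gammaSet_zero_one_ne_zero
  have hS1 : eisensteinSeries (N := 2) ![0, 1] (2 * k) ∣[(2 * k : ℤ)] S =
      eisensteinSeries (N := 2) ![1, 0] (2 * k) := by
    rw [eisensteinSeries_slash_apply]
    congr 1
    decide
  have hS2 : eisensteinSeries (N := 2) ![1, 0] (2 * k) ∣[(2 * k : ℤ)] S =
      eisensteinSeries (N := 2) ![0, 1] (2 * k) := by
    rw [eisensteinSeries_slash_apply]
    congr 1
    decide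
  have hT : eisensteinSeries (N := 2) ![0, 1] (2 * k) ∣[(2 * k : ℤ)] T =
      eisensteinSeries (N := 2) ![0, 1] (2 * k) := by
    rw [eisensteinSeries_slash_apply]
    congr 1
    decide
  have hA1 : A.eval 1 = 0 := by
    rw [← polynomial_slash_S hB hA hS2]
    simp [hB0]
  have hB1 : B.eval 1 ≠ 0 := by
    rw [← polynomial_slash_S hA hB hS1]
    simpa using hL
  have hd := derivative_eval_zero fun c ↦ polynomial_slash_T hA hT (c := c)
  refine ⟨C (1 / 2) * (A + B), C (1 / 2) * (A - B), fun z ↦ ?_, fun z ↦ ?_, ?_, ?_, ?_, ?_, ?_⟩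
  · rw [EPlus, eisSum, eisSum, hA, hB, eval_C_mul, eval_add]; ring
  · rw [EMinus, eisSum, eisSum, hA, hB, eval_C_mul, eval_sub]; ring
  · simpa [hB0] using hL
  · simpa [hB0] using hL
  · simpa [hA1] using hB1
  · simpa [hA1] using hB1
  -- Since `B(0) = 0`, both denominators are `A(0)/2`, and `B'(0)` cancels in the sum.
  · simp only [derivative_C_mul, derivative_add, derivative_sub, eval_C_mul, eval_add, eval_sub,
      hB0, add_zero, sub_zero]
    field_simp
    linear_combination hd

end EisensteinPolynomials

/-! ### Conclusion, applied to the product of the two polynomials. -/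

theorem mainTheorem6 (k : ℕ) (hk : 2 ≤ k) :
    (∀ τ : ℍ, HolNonzeroAt (EPlus k) τ ∧ HolNonzeroAt (EMinus k) τ) ∧
    ∀ rep : Y2 → ℍ, IsRepSystem rep →
      {y : Y2 | ordAt (EPlus k) (rep y) + ordAt (EMinus k) (rep y) ≠ 0}.Finite ∧
      (∑ᶠ y : Y2, ((ordAt (EPlus k) (rep y) : ℂ) + (ordAt (EMinus k) (rep y) : ℂ)) *
        (1 / lambdaFn (rep y))) = (k : ℂ) ∧
      (∑ᶠ y : Y2, (ordAt (fun z => EPlus k z * EMinus k z) (rep y) : ℂ) *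
        (1 / lambdaFn (rep y))) = (k : ℂ) := by
  obtain ⟨P, Q, hP, hQ, hP0, hQ0, hP1, hQ1, hd⟩ := exists_polynomials_EPlus_EMinus hk
  have hPne : P ≠ 0 := by rintro rfl; simp at hP0
  have hQne : Q ≠ 0 := by rintro rfl; simp at hQ0
  have hPQ : P * Q ≠ 0 := mul_ne_zero hPne hQne
  have hprod (z : ℍ) : EPlus k z * EMinus k z =
      H₃ z ^ (2 * k) * (P * Q).eval (lambdaFn z) := by
    rw [hP, hQ, Polynomial.eval_mul]; ring
  have hadd (τ : ℍ) : ordAt (EPlus k) τ + ordAt (EMinus k) τ =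
      (P * Q).rootMultiplicity (lambdaFn τ) := by
    rw [ordAt_eq_rootMultiplicity hP hPne, ordAt_eq_rootMultiplicity hQ hQne,
      Polynomial.rootMultiplicity_mul hPQ]
  refine ⟨fun τ ↦ ⟨holNonzeroAt_of_polynomial hP hPne τ, holNonzeroAt_of_polynomial hQ hQne τ⟩,
    fun rep hrep ↦ ?_⟩
  have hsum := finsum_rootMultiplicity_div hrep (R := P * Q)
    (by rw [Polynomial.eval_mul]; exact mul_ne_zero hP0 hQ0)
    (by rw [Polynomial.eval_mul]; exact mul_ne_zero hP1 hQ1)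
  have hval : -((P * Q).derivative.eval 0 / (P * Q).eval 0) = (k : ℂ) := by
    rw [← neg_neg (k : ℂ), ← hd, Polynomial.derivative_mul, Polynomial.eval_add,
      Polynomial.eval_mul, Polynomial.eval_mul, Polynomial.eval_mul]
    field_simp
  rw [hval] at hsum
  refine ⟨?_, ?_, ?_⟩
  · simp_rw [hadd]
    exact finite_rootMultiplicity_ne_zero hrep hPQ
  · simp_rw [← Nat.cast_add, hadd]
    exact hsum
  · simp_rw [ordAt_eq_rootMultiplicity hprod hPQ]
    exact hsum
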